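/- Let $n\ge 1$ and let $X\sim N(\mu,\sigma^2)$ and $S^2\sim\sigma^2\chi^2_n$ ($S>0$) be independent, with unknown $(\mu,\sigma)\in\Theta=\{\mu\ge 0,\ \sigma>0\}$. The parameter $\mu$ is estimated under the loss $\rho\big(\frac{d-\mu}{\sigma}\big)$, where $\rho:\mathbb R\to\mathbb R$ is convex, $\rho(t)\ge\rho(0)=0$ for all $t$, and $\rho'<0$ a.e. on $(-\infty,0)$, $\rho'>0$ a.e. on $(0,\infty)$. The risk is $R((\mu,\sigma),\delta)=E_{\mu,\sigma}\,\rho\big(\frac{\delta(X,S)-\mu}{\sigma}\big)\in[0,\infty]$. Assume that there is a unique minimum risk equivariant estimator $\delta_0(X,S)=X+c_0S$, that is, $c_0$ is the unique minimizer of $c\mapsto E_{0,1}\,\rho(X+cS)$ over $\mathbb R$, with finite minimum. An estimator $\delta$ dominates $\delta_0$ if $R(\theta,\delta)\le R(\theta,\delta_0)$ for all $\theta\in\Theta$, with strict inequality for some $\theta\in\Theta$; it is minimax if it minimizes $\sup_{\theta\in\Theta}R(\theta,\delta)$ among all (measurable) estimators. Let $C$ be the class of estimators $\delta_g(X,S)=X+c_0S+g(X/S)\,S$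 with $g:\mathbb R\to\mathbb R$ absolutely continuous on bounded intervals, nonincreasing, non-constant, and $\lim_{t\to\infty}g(t)=0$. For $l\ge 0$ let $\delta_{\pi_l}$ be the generalized Bayes estimator with respect to the prior density $\sigma^{-(l+1)}$ on $\Theta$, that is, for every $(x,s)$ with $s>0$ the decision $\delta_{\pi_l}(x,s)$ minimizes the posterior expected loss, with finite minimum; put $g_{\pi_l}(y)=\delta_{\pi_l}(y,1)-y-c_0$. Assume that $\delta_{\pi_0}$ exists. (a) If $|\rho'(-u)|\le\rho'(u)$ for almost every $u\ge 0$, then every $\delta_g\in C$ with $g\le g_{\pi_0}$ dominates $\delta_0$ and is minimax. (b) If $|\rho'(-u)|\le\rho'(u)$ for almost every $u\ge 0$, then $\delta_{\pi_0}=\delta_{g_{\pi_0}}\in C$, and $\delta_{\pi_0}$ dominates $\delta_0$ and is minimax. If $\rho$ is even, then for every $l>0$ for which $\delta_{\pi_l}$ exists, $\delta_{\pi_l}=\delta_{g_{\pi_l}}\in C$, $g_{\pi_l}\le g_{\pi_0}$, and $\delta_{\pi_l}$ dominates $\delta_0$ and is minimax. -/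

import Mathlib

open MeasureTheory ProbabilityTheory Set Filter Topology
open scoped ENNReal

noncomputable section

namespace NormalScale

/-- Density on `(0, ∞)` of the square root of a `χ²_n` variable. -/
def chiPDF (n : ℕ) (v : ℝ) : ℝ :=
  v ^ (n - 1) * Real.exp (-v ^ 2 / 2) / (Real.Gamma ((n : ℝ) / 2) * 2 ^ ((n : ℝ) / 2 - 1))

/-- The sample space of `(X, S)`: pairs `(x, s)` with `s > 0`. -/
def sampleSpace : Set (ℝ × ℝ) := {p | 0 < p.2}

/-- Joint density of `(X, S)` on `sampleSpace`, where `X ∼ N(μ, σ²)` and `S² ∼ σ² χ²_n` are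
independent. -/
def modelPDF (n : ℕ) (μ σ : ℝ) (p : ℝ × ℝ) : ℝ :=
  1 / σ ^ 2 * gaussianPDFReal 0 1 ((p.1 - μ) / σ) * chiPDF n (p.2 / σ)

/-- The law of `(X, S)` under the parameter `(μ, σ)`. -/
def model (n : ℕ) (μ σ : ℝ) : Measure (ℝ × ℝ) :=
  (volume.restrict sampleSpace).withDensity fun p => ENNReal.ofReal (modelPDF n μ σ p)

/-- Estimators are the functions that are measurable on the sample space; their values at
`s ≤ 0` are irrelevant. -/
def IsEstimator (δ : ℝ × ℝ → ℝ) : Prop :=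
  Measurable (sampleSpace.domRestrict δ)

/-- Frequentist risk `E_{μ,σ} ρ((δ(X,S) - μ)/σ)`, with values in `[0, ∞]`. -/
def risk (n : ℕ) (ρ : ℝ → ℝ) (δ : ℝ × ℝ → ℝ) (μ σ : ℝ) : ℝ≥0∞ :=
  ∫⁻ p, ENNReal.ofReal (ρ ((δ p - μ) / σ)) ∂(model n μ σ)

/-- The parameter space `μ ≥ 0`, `σ > 0`. -/
def paramSpace : Set (ℝ × ℝ) := {θ | 0 ≤ θ.1 ∧ 0 < θ.2}

/-- Worst-case risk over the parameter space. -/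
def maxRisk (n : ℕ) (ρ : ℝ → ℝ) (δ : ℝ × ℝ → ℝ) : ℝ≥0∞ :=
  ⨆ θ ∈ paramSpace, risk n ρ δ θ.1 θ.2

/-- `δ` is a minimax estimator over the parameter space. -/
def IsMinimax (n : ℕ) (ρ : ℝ → ℝ) (δ : ℝ × ℝ → ℝ) : Prop :=
  IsEstimator δ ∧ ∀ δ' : ℝ × ℝ → ℝ, IsEstimator δ' → maxRisk n ρ δ ≤ maxRisk n ρ δ'

/-- `δ` dominates `δ'` over the parameter space. -/
def Dominates (n : ℕ) (ρ : ℝ → ℝ) (δ δ' : ℝ × ℝ → ℝ) : Prop :=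
  (∀ θ ∈ paramSpace, risk n ρ δ θ.1 θ.2 ≤ risk n ρ δ' θ.1 θ.2) ∧
    ∃ θ ∈ paramSpace, risk n ρ δ θ.1 θ.2 < risk n ρ δ' θ.1 θ.2

/-- Convex, strictly bowl-shaped losses with minimum value `ρ 0 = 0`. A convex function is
differentiable off a countable set, so conditions on `ρ'` are imposed almost everywhere
(`ρ = |·|` is allowed). -/
structure IsConvexLoss (ρ : ℝ → ℝ) : Prop where
  convex : ConvexOn ℝ univ ρ
  zero : ρ 0 = 0
  nonneg : ∀ t, 0 ≤ ρ t
  deriv_neg : ∀ᵐ t : ℝ, t < 0 → deriv ρ t < 0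
  deriv_pos : ∀ᵐ t : ℝ, 0 < t → 0 < deriv ρ t

/-- Over-estimation is penalized at least as sharply as under-estimation:
`|ρ'(-u)| ≤ ρ'(u)` for `u ≥ 0` (wherever the derivatives exist, that is almost everywhere). -/
def PenalizesOver (ρ : ℝ → ℝ) : Prop :=
  ∀ᵐ u : ℝ, 0 ≤ u → |deriv ρ (-u)| ≤ deriv ρ u

/-- The location-scale equivariant estimator `X + c S`. -/
def equivariant (c : ℝ) (p : ℝ × ℝ) : ℝ := p.1 + c * p.2

/-- `X + c₀ S` is the unique minimum risk equivariant estimator of the unconstrained problem.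
The strict inequalities force its (constant) risk to be finite. -/
def IsMRE (n : ℕ) (ρ : ℝ → ℝ) (c₀ : ℝ) : Prop :=
  ∀ c : ℝ, c ≠ c₀ → risk n ρ (equivariant c₀) 0 1 < risk n ρ (equivariant c) 0 1

/-- The estimator `δ_g(X,S) = X + c₀ S + g(X/S) S`. -/
def expand (c₀ : ℝ) (g : ℝ → ℝ) (p : ℝ × ℝ) : ℝ :=
  equivariant c₀ p + g (p.1 / p.2) * p.2

/-- The functions `g` for which `δ_g` belongs to the class `C`. -/
structure ClassC (g : ℝ → ℝ) : Prop where
  absolutelyContinuous : ∀ a b : ℝ, AbsolutelyContinuousOnInterval g a b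
  antitone : Antitone g
  nonconstant : ¬ ∃ c : ℝ, ∀ y, g y = c
  tendsto_zero : Tendsto g atTop (𝓝 0)

/-- Integral of the loss of the decision `d` at the observation `(x, s)` against likelihood times
the prior density `σ^{-(l+1)}` on `μ ≥ 0`, `σ > 0`: the posterior expected loss up to the
normalizing constant, which depends on `(x, s)` only. -/
def posteriorLoss (n : ℕ) (ρ : ℝ → ℝ) (l : ℝ) (p : ℝ × ℝ) (d : ℝ) : ℝ≥0∞ :=
  ∫⁻ θ in paramSpace,
    ENNReal.ofReal (ρ ((d - θ.1) / θ.2)) *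
      ENNReal.ofReal (modelPDF n θ.1 θ.2 p * θ.2 ^ (-(l + 1)))

/-- `δ` is the generalized Bayes estimator with respect to the prior `σ^{-(l+1)}` on `μ ≥ 0`,
`σ > 0`: at every observation its posterior expected loss is finite and minimal. -/
def IsGenBayes (n : ℕ) (ρ : ℝ → ℝ) (l : ℝ) (δ : ℝ × ℝ → ℝ) : Prop :=
  ∀ p ∈ sampleSpace, posteriorLoss n ρ l p (δ p) < ∞ ∧
    ∀ d : ℝ, posteriorLoss n ρ l p (δ p) ≤ posteriorLoss n ρ l p d

/-- The function `g` such that `δ = δ_g`, for a scale equivariant `δ`; it is read off at `s = 1`. -/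
def expansion (c₀ : ℝ) (δ : ℝ × ℝ → ℝ) (y : ℝ) : ℝ := δ (y, 1) - equivariant c₀ (y, 1)

/-- `δ` is, on the sample space, the member `δ_g` of the class `C` with `g = expansion c₀ δ`. -/
def MemClassC (c₀ : ℝ) (δ : ℝ × ℝ → ℝ) : Prop :=
  ClassC (expansion c₀ δ) ∧ ∀ p ∈ sampleSpace, δ p = expand c₀ (expansion c₀ δ) p

end NormalScale

end

open NormalScale

noncomputable section

/-! With z = (X - μ)/σ and v = S/σ, risks and posterior losses become integrals against v^m exp(-(z²
+ v²)/2) on v > 0, where m = n - 1 for the risk and m = n - 1 + l for the posterior. Bayes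
estimation at t = x/s minimizes the expected loss of z + cv over the wedge z ≤ tv; call the
minimizer f(t) = c₀ + g_π(t). The constant c₀ minimizes the same loss over the whole half plane when
m = n - 1. By convexity a coefficient lies below or above the minimizer according to the sign of the
derivative in c, which is split into `overPart` and `underPart`.

Domination rests on an integral expression of the risk difference (`expandedLoss_add_under`). For η
= μ/σ the difference between the risks of δ_g and δ₀ is the integral over γ > 0 of the derivative at
c₀ + γ, taken over the set where g((η + z)/v) > γ. As g is nonincreasing, this set is a wedge z + η
≤ τv up to a null set. For η = 0 the derivative is nonpositive, because g ≤ g_π puts c₀ + γ below f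
to the left of τ. The sign survives for η > 0 (`overPart_le_underPart_shift`).

All sign comparisons use the coordinates u = z + cv, w = √(1 + c²) v. Integrating out w leaves a
`tailWeight` at each estimation error u, and only its size at u > 0 relative to u < 0 matters.
Pointwise bounds make f nonincreasing with limit c₀; a reflection u ↦ -u uses the asymmetry of the
loss to bound f from above, which yields local Lipschitz continuity and the condition ct ≤ 1 for the
shift in η; Chebyshev's inequality handles that shift and the comparison of different l.

Minimaxity then follows because the constant risk of δ₀ is a lower bound for every worst-case risk
(`le_maxRisk`): uniform priors for (μ, log σ) on large boxes in μ ≥ 0 are almost invariant under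
translation and scaling. -/

namespace NormalScale

/-! ### Subgradients of the loss -/

section

/-- `q` is a nondecreasing selection of subgradients of the strictly bowl-shaped loss `ρ`. -/
structure IsSubderivative (ρ q : ℝ → ℝ) : Prop where
  monotone : Monotone q
  map_zero : q 0 = 0
  subgradient : ∀ x y, ρ x + q x * (y - x) ≤ ρ y
  neg_of_neg : ∀ x, x < 0 → q x < 0
  pos_of_pos : ∀ x, 0 < x → 0 < q x
  integral_eq : ∀ a b, ∫ u in a..b, q u = ρ b - ρ a

/-- The right derivative of the loss, with the value `0` at the origin. -/
def subderiv (ρ : ℝ → ℝ) (u : ℝ) : ℝ := if u = 0 then 0 else derivWithin ρ (Ioi u) u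

lemma exists_mem_Ioo_of_ae {P : ℝ → Prop} (h : ∀ᵐ t : ℝ, P t) {a b : ℝ} (hab : a < b) :
    ∃ t ∈ Ioo a b, P t := by
  by_contra! hcon
  have hsub : Ioo a b ⊆ {t | ¬ P t} := fun t ht => hcon t ht
  have h0 : volume (Ioo a b) = 0 := measure_mono_null hsub h
  rw [Real.volume_Ioo, ENNReal.ofReal_eq_zero] at h0
  linarith

variable {ρ : ℝ → ℝ}

lemma IsConvexLoss.continuous (hρ : IsConvexLoss ρ) : Continuous ρ :=
  continuousOn_univ.1 (hρ.convex.continuousOn isOpen_univ)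

lemma IsConvexLoss.measurable (hρ : IsConvexLoss ρ) : Measurable ρ := hρ.continuous.measurable

lemma derivWithin_Ioi_eq_deriv {x : ℝ} (h : deriv ρ x ≠ 0) :
    derivWithin ρ (Ioi x) x = deriv ρ x :=
  (differentiableAt_of_deriv_ne_zero h).derivWithin (uniqueDiffWithinAt_Ioi x)

lemma IsConvexLoss.rightDeriv_mono (hρ : IsConvexLoss ρ) :
    Monotone fun x => derivWithin ρ (Ioi x) x := by
  have := hρ.convex.monotoneOn_rightDeriv
  rw [interior_univ] at this
  exact monotoneOn_univ.1 this

lemma IsConvexLoss.rightDeriv_neg (hρ : IsConvexLoss ρ) {x : ℝ} (hx : x < 0) :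
    derivWithin ρ (Ioi x) x < 0 := by
  obtain ⟨y, hy, hd⟩ := exists_mem_Ioo_of_ae hρ.deriv_neg hx
  have h := hd hy.2
  have := hρ.rightDeriv_mono hy.1.le
  simp only [derivWithin_Ioi_eq_deriv h.ne] at this
  linarith

lemma IsConvexLoss.rightDeriv_pos (hρ : IsConvexLoss ρ) {x : ℝ} (hx : 0 < x) :
    0 < derivWithin ρ (Ioi x) x := by
  obtain ⟨y, hy, hd⟩ := exists_mem_Ioo_of_ae hρ.deriv_pos hx
  have h := hd hy.1
  have := hρ.rightDeriv_mono hy.2.le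
  simp only [derivWithin_Ioi_eq_deriv h.ne'] at this
  linarith

/-- A kink at the origin may make the right derivative positive there. The value 0 is still a
subgradient because ρ is minimal at 0, and it keeps `q` monotone because right derivatives are
negative to the left of 0 and positive to the right. -/
lemma IsConvexLoss.isSubderivative (hρ : IsConvexLoss ρ) :
    IsSubderivative ρ (subderiv ρ) := by
  have hneg : ∀ x, x < 0 → subderiv ρ x < 0 := fun x hx => by
    simpa [subderiv, hx.ne] using hρ.rightDeriv_neg hx
  have hpos : ∀ x, 0 < x → 0 < subderiv ρ x := fun x hx => by
    simpa [subderiv, hx.ne'] using hρ.rightDeriv_pos hx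
  have h0 : subderiv ρ 0 = 0 := by simp [subderiv]
  have hmono : Monotone (subderiv ρ) := by
    intro x y hxy
    rcases eq_or_ne x 0 with rfl | hx
    · rcases hxy.eq_or_lt with rfl | hy
      · rfl
      · rw [h0]; exact (hpos _ hy).le
    rcases eq_or_ne y 0 with rfl | hy
    · rw [h0]; exact (hneg _ (lt_of_le_of_ne hxy hx)).le
    · simpa [subderiv, hx, hy] using hρ.rightDeriv_mono hxy
  have hder : ∀ x, HasDerivWithinAt ρ (derivWithin ρ (Ioi x) x) (Ioi x) x := fun x =>
    hρ.convex.hasDerivWithinAt_rightDeriv_of_mem_interior (by simp)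
  refine ⟨hmono, h0, ?_, hneg, hpos, ?_⟩
  · intro x y
    rcases eq_or_ne x 0 with rfl | hx
    · rw [h0, hρ.zero]; simpa using hρ.nonneg y
    have hq : subderiv ρ x = derivWithin ρ (Ioi x) x := by simp [subderiv, hx]
    rw [hq]
    rcases lt_trichotomy x y with hxy | rfl | hxy
    · have := hρ.convex.rightDeriv_le_slope_of_mem_interior (by simp) (mem_univ y) hxy
      rw [slope_def_field, le_div_iff₀ (by linarith)] at this
      linarith
    · simp
    · have h1 := hρ.convex.slope_le_leftDeriv_of_mem_interior (mem_univ y)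
        (by simp : x ∈ interior univ) hxy
      have h2 := hρ.convex.leftDeriv_le_rightDeriv_of_mem_interior (by simp : x ∈ interior univ)
      have h3 := h1.trans h2
      rw [slope_def_field, div_le_iff₀ (by linarith)] at h3
      linarith
  · intro a b
    have hae : ∀ᵐ u : ℝ, subderiv ρ u = derivWithin ρ (Ioi u) u := by
      filter_upwards [compl_mem_ae_iff.2 (measure_singleton (0 : ℝ))] with u hu
      have : u ≠ 0 := hu
      simp [subderiv, this]
    rw [intervalIntegral.integral_congr_ae (hae.mono fun u hu _ => hu)]
    exact intervalIntegral.integral_eq_sub_of_hasDeriv_right hρ.continuous.continuousOn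
      (fun x _ => hder x) hρ.rightDeriv_mono.intervalIntegrable

lemma IsConvexLoss.ae_subderiv_eq (hρ : IsConvexLoss ρ) :
    ∀ᵐ u : ℝ, subderiv ρ u = deriv ρ u := by
  filter_upwards [hρ.deriv_neg, hρ.deriv_pos, compl_mem_ae_iff.2 (measure_singleton (0 : ℝ))]
    with u h1 h2 h3
  have h3 : u ≠ 0 := h3
  have : deriv ρ u ≠ 0 := by
    rcases lt_or_gt_of_ne h3 with h | h
    · exact (h1 h).ne
    · exact (h2 h).ne'
  simp [subderiv, h3, derivWithin_Ioi_eq_deriv this]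

lemma PenalizesOver.subderiv_le (hρ : IsConvexLoss ρ) (h : PenalizesOver ρ) :
    ∀ᵐ u : ℝ, 0 < u → -subderiv ρ (-u) ≤ subderiv ρ u := by
  have h1 := hρ.ae_subderiv_eq
  have h2 : ∀ᵐ u : ℝ, subderiv ρ (-u) = deriv ρ (-u) :=
    (Measure.measurePreserving_neg (volume : Measure ℝ)).quasiMeasurePreserving.ae h1
  filter_upwards [h, h1, h2] with u hu h1 h2 hpos
  rw [h1, h2]
  exact (neg_le_abs _).trans (hu hpos.le)

lemma penalizesOver_of_even (hρ : IsConvexLoss ρ) (h : Function.Even ρ) : PenalizesOver ρ := by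
  filter_upwards [hρ.deriv_pos] with u hu hu0
  have hd : deriv ρ (-u) = -deriv ρ u := by
    have := deriv_comp_neg ρ u
    have h2 : (fun x => ρ (-x)) = ρ := funext h
    rw [h2] at this
    linarith
  rw [hd, abs_neg]
  rcases hu0.eq_or_lt with rfl | h0
  · rw [neg_zero] at hd
    have : deriv ρ 0 = 0 := by linarith
    simp [this]
  · exact (abs_of_pos (hu h0)).le

namespace IsSubderivative

variable {q : ℝ → ℝ}

lemma nonneg (hq : IsSubderivative ρ q) {x : ℝ} (hx : 0 ≤ x) : 0 ≤ q x := by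
  simpa [hq.map_zero] using hq.monotone hx

lemma nonpos (hq : IsSubderivative ρ q) {x : ℝ} (hx : x ≤ 0) : q x ≤ 0 := by
  simpa [hq.map_zero] using hq.monotone hx

end IsSubderivative

end

/-! ### Expected loss over a region and its first-order conditions -/

section

/-- The measure `v ^ m * exp (-(z² + v²) / 2)` on the half plane `v > 0`. -/
def kernelMeasure (m : ℝ) : Measure (ℝ × ℝ) :=
  (volume.restrict sampleSpace).withDensity fun p =>
    ENNReal.ofReal (p.2 ^ m * Real.exp (-(p.1 ^ 2 + p.2 ^ 2) / 2))

/-- The expected loss of `z + c v` over the region `A`. -/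
def regionLoss (ρ : ℝ → ℝ) (m : ℝ) (A : Set (ℝ × ℝ)) (c : ℝ) : ℝ≥0∞ :=
  ∫⁻ p in A, ENNReal.ofReal (ρ (p.1 + c * p.2)) ∂kernelMeasure m

/-- The contribution of over-estimation to the derivative of `regionLoss` in `c`. -/
def overPart (q : ℝ → ℝ) (m : ℝ) (A : Set (ℝ × ℝ)) (c : ℝ) : ℝ≥0∞ :=
  ∫⁻ p in A, ENNReal.ofReal (q (p.1 + c * p.2) * p.2) ∂kernelMeasure m

/-- The contribution of under-estimation to minus the derivative of `regionLoss` in `c`. -/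
def underPart (q : ℝ → ℝ) (m : ℝ) (A : Set (ℝ × ℝ)) (c : ℝ) : ℝ≥0∞ :=
  ∫⁻ p in A, ENNReal.ofReal (-q (p.1 + c * p.2) * p.2) ∂kernelMeasure m

/-- The coefficient `c` has finite and minimal expected loss over the region `A`. -/
def IsOptimal (ρ : ℝ → ℝ) (m : ℝ) (A : Set (ℝ × ℝ)) (c : ℝ) : Prop :=
  regionLoss ρ m A c < ∞ ∧ ∀ d, regionLoss ρ m A c ≤ regionLoss ρ m A d

/-- The region `z + η ≤ t v`. -/
def wedge (t η : ℝ) : Set (ℝ × ℝ) := {p | p.1 + η ≤ t * p.2}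

/-- The region `A` contains all points at which `z + c v` is an under-estimate. -/
def ContainsUnder (A : Set (ℝ × ℝ)) (c : ℝ) : Prop :=
  ∀ p : ℝ × ℝ, 0 < p.2 → p.1 + c * p.2 < 0 → p ∈ A

lemma measurableSet_sampleSpace : MeasurableSet sampleSpace :=
  measurableSet_lt measurable_const measurable_snd

lemma measurableSet_wedge (t η : ℝ) : MeasurableSet (wedge t η) :=
  measurableSet_le (by fun_prop) (by fun_prop)

lemma measurable_kernel (m : ℝ) : Measurable fun p : ℝ × ℝ =>
    ENNReal.ofReal (p.2 ^ m * Real.exp (-(p.1 ^ 2 + p.2 ^ 2) / 2)) := by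
  fun_prop

lemma kernelMeasure_absolutelyContinuous (m : ℝ) : kernelMeasure m ≪ volume :=
  (withDensity_absolutelyContinuous _ _).trans Measure.restrict_le_self.absolutelyContinuous

lemma ae_kernelMeasure_snd_pos (m : ℝ) : ∀ᵐ p ∂kernelMeasure m, 0 < p.2 :=
  (withDensity_absolutelyContinuous _ _).ae_le (ae_restrict_mem measurableSet_sampleSpace)

instance (m : ℝ) : SFinite (kernelMeasure m) := by
  unfold kernelMeasure; infer_instance

lemma kernelMeasure_ne_zero (m : ℝ) {U : Set (ℝ × ℝ)} (hU : IsOpen U) (hne : U.Nonempty)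
    (hsub : U ⊆ sampleSpace) : kernelMeasure m U ≠ 0 := by
  have hac : volume.restrict sampleSpace ≪ kernelMeasure m := by
    refine withDensity_absolutelyContinuous' (measurable_kernel m).aemeasurable ?_
    filter_upwards [ae_restrict_mem measurableSet_sampleSpace] with p hp
    have hp : 0 < p.2 := hp
    simp only [ne_eq, ENNReal.ofReal_eq_zero, not_le]
    positivity
  intro h0
  have h1 := hac h0
  rw [Measure.restrict_apply hU.measurableSet, inter_eq_left.2 hsub] at h1
  exact (hU.measure_pos volume hne).ne' h1

lemma lintegral_kernelMeasure (m : ℝ) (f : ℝ × ℝ → ℝ≥0∞) :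
    ∫⁻ p, f p ∂kernelMeasure m = ∫⁻ p in sampleSpace,
      ENNReal.ofReal (p.2 ^ m * Real.exp (-(p.1 ^ 2 + p.2 ^ 2) / 2)) * f p := by
  unfold kernelMeasure
  rw [lintegral_withDensity_eq_lintegral_mul_non_measurable _ (measurable_kernel m)
    (Eventually.of_forall fun _ => ENNReal.ofReal_lt_top)]
  rfl

variable {ρ q : ℝ → ℝ} {m c c' t η : ℝ} {A B : Set (ℝ × ℝ)}

@[fun_prop]
lemma IsSubderivative.measurable (hq : IsSubderivative ρ q) : Measurable q :=
  hq.monotone.measurable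

lemma IsSubderivative.measurable_over (hq : IsSubderivative ρ q) (c : ℝ) :
    Measurable fun p : ℝ × ℝ => ENNReal.ofReal (q (p.1 + c * p.2) * p.2) :=
  ((hq.measurable.comp (by fun_prop)).mul measurable_snd).ennreal_ofReal

lemma IsSubderivative.measurable_under (hq : IsSubderivative ρ q) (c : ℝ) :
    Measurable fun p : ℝ × ℝ => ENNReal.ofReal (-q (p.1 + c * p.2) * p.2) :=
  ((hq.measurable.comp (by fun_prop)).neg.mul measurable_snd).ennreal_ofReal

lemma measurable_loss (hρ : IsConvexLoss ρ) (c : ℝ) :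
    Measurable fun p : ℝ × ℝ => ENNReal.ofReal (ρ (p.1 + c * p.2)) :=
  (hρ.measurable.comp (by fun_prop)).ennreal_ofReal

lemma overPart_mono (hq : IsSubderivative ρ q) (h : c ≤ c') :
    overPart q m A c ≤ overPart q m A c' := by
  refine lintegral_mono_ae ?_
  filter_upwards [ae_restrict_of_ae (ae_kernelMeasure_snd_pos m)] with p hp
  have : q (p.1 + c * p.2) ≤ q (p.1 + c' * p.2) := hq.monotone (by gcongr)
  gcongr

lemma underPart_anti (hq : IsSubderivative ρ q) (h : c ≤ c') :
    underPart q m A c' ≤ underPart q m A c := by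
  refine lintegral_mono_ae ?_
  filter_upwards [ae_restrict_of_ae (ae_kernelMeasure_snd_pos m)] with p hp
  have : q (p.1 + c * p.2) ≤ q (p.1 + c' * p.2) := hq.monotone (by gcongr)
  gcongr

/-- The open set where z + cv < 0 < z + c'v has positive measure and lies in `A`; on it the
under-estimation term drops from a positive value to zero. -/
lemma underPart_strictAnti (hq : IsSubderivative ρ q) (hA : ContainsUnder A c) (h : c < c')
    (hfin : underPart q m A c' ≠ ∞) : underPart q m A c' < underPart q m A c := by
  have hU : IsOpen {p : ℝ × ℝ | 0 < p.2 ∧ p.1 + c * p.2 < 0 ∧ 0 < p.1 + c' * p.2} :=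
    (isOpen_lt (by fun_prop) (by fun_prop)).and
      ((isOpen_lt (by fun_prop) (by fun_prop)).and (isOpen_lt (by fun_prop) (by fun_prop)))
  set U := {p : ℝ × ℝ | 0 < p.2 ∧ p.1 + c * p.2 < 0 ∧ 0 < p.1 + c' * p.2}
  have hUA : U ⊆ A := fun p hp => hA p hp.1 hp.2.1
  have hne : kernelMeasure m U ≠ 0 := by
    refine kernelMeasure_ne_zero m hU ⟨(-(c + c') / 2, 1), ?_⟩ fun p hp => hp.1
    refine ⟨by norm_num, ?_, ?_⟩ <;> simp only [] <;> linarith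
  refine lintegral_strict_mono_of_ae_le_of_ae_lt_on
    (s := U) (hq.measurable_under c).aemeasurable hfin ?_ ?_ ?_
  · filter_upwards [ae_restrict_of_ae (ae_kernelMeasure_snd_pos m)] with p hp
    have : q (p.1 + c * p.2) ≤ q (p.1 + c' * p.2) := hq.monotone (by gcongr)
    gcongr
  · rwa [Measure.restrict_apply hU.measurableSet, inter_eq_left.2 hUA]
  · refine Eventually.of_forall fun p hp => ?_
    have h1 := hq.neg_of_neg _ hp.2.1
    have h2 := hq.pos_of_pos _ hp.2.2
    refine (ENNReal.ofReal_lt_ofReal_iff (mul_pos (by linarith) hp.1)).2 ?_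
    exact mul_lt_mul_of_pos_right (by linarith) hp.1

/-- The subgradient inequality and ρ ≥ 0 bound (c' - c) times the integrand by the loss at c'. -/
lemma overPart_finite (hρ : IsConvexLoss ρ) (hq : IsSubderivative ρ q)
    (h : regionLoss ρ m A c' < ∞) (hc : c < c') : overPart q m A c < ∞ := by
  have hpos : 0 < c' - c := sub_pos.2 hc
  have key : ENNReal.ofReal (c' - c) * overPart q m A c ≤ regionLoss ρ m A c' := by
    unfold overPart regionLoss
    rw [← lintegral_const_mul _ (hq.measurable_over c)]
    refine lintegral_mono fun p => ?_
    rw [← ENNReal.ofReal_mul hpos.le]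
    refine ENNReal.ofReal_le_ofReal ?_
    have := hq.subgradient (p.1 + c * p.2) (p.1 + c' * p.2)
    have := hρ.nonneg (p.1 + c * p.2)
    nlinarith
  by_contra hcon
  rw [not_lt, top_le_iff] at hcon
  rw [hcon, ENNReal.mul_top (by simpa using hpos)] at key
  exact absurd h (not_lt.2 key)

lemma underPart_finite (hρ : IsConvexLoss ρ) (hq : IsSubderivative ρ q)
    (h : regionLoss ρ m A c' < ∞) (hc : c' < c) : underPart q m A c < ∞ := by
  have hpos : 0 < c - c' := sub_pos.2 hc
  have key : ENNReal.ofReal (c - c') * underPart q m A c ≤ regionLoss ρ m A c' := by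
    unfold underPart regionLoss
    rw [← lintegral_const_mul _ (hq.measurable_under c)]
    refine lintegral_mono fun p => ?_
    rw [← ENNReal.ofReal_mul hpos.le]
    refine ENNReal.ofReal_le_ofReal ?_
    have := hq.subgradient (p.1 + c * p.2) (p.1 + c' * p.2)
    have := hρ.nonneg (p.1 + c * p.2)
    nlinarith
  by_contra hcon
  rw [not_lt, top_le_iff] at hcon
  rw [hcon, ENNReal.mul_top (by simpa using hpos)] at key
  exact absurd h (not_lt.2 key)

/-- This is the subgradient inequality without subtraction, with the slope split into its positive
and negative parts. It can be integrated even where one of the parts has infinite integral. -/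
lemma ofReal_add_mul_le {x y k a b : ℝ} (hx : 0 ≤ x) (hk : 0 ≤ k)
    (hab : b = -a) (h : x + a * k ≤ y) :
    ENNReal.ofReal x + ENNReal.ofReal k * ENNReal.ofReal a ≤
      ENNReal.ofReal y + ENNReal.ofReal k * ENNReal.ofReal b := by
  subst hab
  rcases le_total 0 a with ha | ha
  · rw [← ENNReal.ofReal_mul hk, ← ENNReal.ofReal_add hx (by positivity)]
    refine le_add_right (ENNReal.ofReal_le_ofReal ?_)
    linarith
  · rw [ENNReal.ofReal_of_nonpos ha, mul_zero, add_zero, ← ENNReal.ofReal_mul hk]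
    refine le_trans (ENNReal.ofReal_le_ofReal ?_) ENNReal.ofReal_add_le
    linarith

lemma IsOptimal.overPart_le_underPart (hρ : IsConvexLoss ρ) (hq : IsSubderivative ρ q)
    (h : IsOptimal ρ m A c') (hc : c < c') : overPart q m A c ≤ underPart q m A c := by
  have hpos : 0 < c' - c := sub_pos.2 hc
  have key : regionLoss ρ m A c + ENNReal.ofReal (c' - c) * overPart q m A c ≤
      regionLoss ρ m A c' + ENNReal.ofReal (c' - c) * underPart q m A c := by
    unfold overPart underPart regionLoss
    rw [← lintegral_const_mul _ (hq.measurable_over c),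
      ← lintegral_const_mul _ (hq.measurable_under c),
      ← lintegral_add_left (measurable_loss hρ c), ← lintegral_add_left (measurable_loss hρ c')]
    refine lintegral_mono fun p => ofReal_add_mul_le (hρ.nonneg _) hpos.le (by ring) ?_
    have := hq.subgradient (p.1 + c * p.2) (p.1 + c' * p.2)
    linarith
  have key2 := (add_le_add_left (h.2 c) _).trans key
  have key3 := (ENNReal.add_le_add_iff_left h.1.ne).1 key2
  exact (ENNReal.mul_le_mul_iff_right (by simpa using hpos) ENNReal.ofReal_ne_top).1 key3

lemma IsOptimal.underPart_le_overPart (hρ : IsConvexLoss ρ) (hq : IsSubderivative ρ q)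
    (h : IsOptimal ρ m A c') (hc : c' < c) : underPart q m A c ≤ overPart q m A c := by
  have hpos : 0 < c - c' := sub_pos.2 hc
  have key : regionLoss ρ m A c + ENNReal.ofReal (c - c') * underPart q m A c ≤
      regionLoss ρ m A c' + ENNReal.ofReal (c - c') * overPart q m A c := by
    unfold overPart underPart regionLoss
    rw [← lintegral_const_mul _ (hq.measurable_over c),
      ← lintegral_const_mul _ (hq.measurable_under c),
      ← lintegral_add_left (measurable_loss hρ c), ← lintegral_add_left (measurable_loss hρ c')]
    refine lintegral_mono fun p => ofReal_add_mul_le (hρ.nonneg _) hpos.le (by ring) ?_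
    have := hq.subgradient (p.1 + c * p.2) (p.1 + c' * p.2)
    linarith
  have key2 := (add_le_add_left (h.2 c) _).trans key
  have key3 := (ENNReal.add_le_add_iff_left h.1.ne).1 key2
  exact (ENNReal.mul_le_mul_iff_right (by simpa using hpos) ENNReal.ofReal_ne_top).1 key3

lemma ContainsUnder.mono (h : ContainsUnder A c) (hc : c ≤ c') : ContainsUnder A c' :=
  fun p hp hlt => h p hp (lt_of_le_of_lt (by gcongr) hlt)

/-- The weak inequality at an intermediate point becomes strict at `c` by strict monotonicity of the
under part. If that part is infinite, finiteness of the over part suffices. -/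
lemma IsOptimal.overPart_lt_underPart (hρ : IsConvexLoss ρ) (hq : IsSubderivative ρ q)
    (h : IsOptimal ρ m A c') (hA : ContainsUnder A c) (hc : c < c') :
    overPart q m A c < underPart q m A c := by
  obtain ⟨d, hd1, hd2⟩ := exists_between hc
  by_cases hfin : underPart q m A d = ∞
  · have := underPart_anti (m := m) (A := A) hq hd1.le
    rw [hfin, top_le_iff] at this
    rw [this]
    exact overPart_finite hρ hq h.1 hc
  · exact ((overPart_mono hq hd1.le).trans (h.overPart_le_underPart hρ hq hd2)).trans_lt
      (underPart_strictAnti hq hA hd1 hfin)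

lemma IsOptimal.underPart_lt_overPart (hρ : IsConvexLoss ρ) (hq : IsSubderivative ρ q)
    (h : IsOptimal ρ m A c') (hA : ContainsUnder A c') (hc : c' < c) :
    underPart q m A c < overPart q m A c := by
  obtain ⟨d, hd1, hd2⟩ := exists_between hc
  exact (underPart_strictAnti hq (hA.mono hd1.le) hd2 (underPart_finite hρ hq h.1 hc).ne).trans_le
    ((h.underPart_le_overPart hρ hq hd1).trans (overPart_mono hq hd2.le))

lemma containsUnder_univ (c : ℝ) : ContainsUnder univ c := fun _ _ _ => mem_univ _

lemma containsUnder_wedge (h : -t ≤ c) : ContainsUnder (wedge t 0) c := by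
  intro p hp hlt
  simp only [wedge, mem_ofPred_eq]
  nlinarith

lemma overPart_wedge_eq_zero (hq : IsSubderivative ρ q) (hη : 0 ≤ η) (h : c ≤ -t) :
    overPart q m (wedge t η) c = 0 := by
  unfold overPart
  rw [lintegral_eq_zero_iff (hq.measurable_over c)]
  filter_upwards [ae_restrict_of_ae (ae_kernelMeasure_snd_pos m),
    ae_restrict_mem (measurableSet_wedge t η)] with p hp hpw
  simp only [wedge, mem_ofPred_eq] at hpw
  have : q (p.1 + c * p.2) ≤ 0 := hq.nonpos (by nlinarith)
  exact ENNReal.ofReal_of_nonpos (mul_nonpos_of_nonpos_of_nonneg this hp.le)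

lemma underPart_wedge_pos (hq : IsSubderivative ρ q) (t η c : ℝ) :
    0 < underPart q m (wedge t η) c := by
  have hU : IsOpen {p : ℝ × ℝ | 0 < p.2 ∧ p.1 + η < t * p.2 ∧ p.1 + c * p.2 < 0} :=
    (isOpen_lt (by fun_prop) (by fun_prop)).and
      ((isOpen_lt (by fun_prop) (by fun_prop)).and (isOpen_lt (by fun_prop) (by fun_prop)))
  set U := {p : ℝ × ℝ | 0 < p.2 ∧ p.1 + η < t * p.2 ∧ p.1 + c * p.2 < 0}
  have hUA : U ⊆ wedge t η := fun p hp => hp.2.1.le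
  have hne : kernelMeasure m U ≠ 0 := by
    refine kernelMeasure_ne_zero m hU ⟨(min (t - η) (-c) - 1, 1), ?_⟩ fun p hp => hp.1
    refine ⟨by norm_num, ?_, ?_⟩ <;> simp only []
    · linarith [min_le_left (t - η) (-c)]
    · linarith [min_le_right (t - η) (-c)]
  rw [pos_iff_ne_zero]
  unfold underPart
  rw [ne_eq, lintegral_eq_zero_iff (hq.measurable_under c)]
  intro h0
  refine hne (measure_mono_null (fun p hp => ?_)
    (ae_iff.1 ((ae_restrict_iff' (measurableSet_wedge t η)).1 h0)))
  have := hq.neg_of_neg _ hp.2.2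
  have h2 : 0 < -q (p.1 + c * p.2) * p.2 := mul_pos (by linarith) hp.1
  simp only [mem_ofPred_eq, Pi.zero_apply, ENNReal.ofReal_eq_zero, Classical.not_imp, not_le]
  exact ⟨hUA hp, h2⟩

/-- Below -t every point of the wedge is an under-estimate, so raising the coefficient reduces the
loss. -/
lemma IsOptimal.neg_le (hρ : IsConvexLoss ρ) (hq : IsSubderivative ρ q)
    (h : IsOptimal ρ m (wedge t 0) c) : -t ≤ c := by
  by_contra! hlt
  obtain ⟨d, hd1, hd2⟩ := exists_between hlt
  have h1 := h.underPart_le_overPart hρ hq hd1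
  rw [overPart_wedge_eq_zero hq le_rfl hd2.le] at h1
  exact (underPart_wedge_pos hq t 0 d).not_ge h1

end

/-! ### Chebyshev's inequality and the rotated coordinates -/

section

lemma lintegral_comp_mul_left {a : ℝ} (ha : a ≠ 0) (f : ℝ → ℝ≥0∞) :
    ∫⁻ x, f (a * x) = ENNReal.ofReal |a⁻¹| * ∫⁻ x, f x := by
  have h := lintegral_map_equiv (μ := volume) f (Homeomorph.mulLeft₀ a ha).toMeasurableEquiv
  have hm : Measure.map (Homeomorph.mulLeft₀ a ha).toMeasurableEquiv (volume : Measure ℝ) =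
      ENNReal.ofReal |a⁻¹| • volume := Real.map_volume_mul_left ha
  rw [hm, lintegral_smul_measure] at h
  exact h.symm

lemma crossMul_add_le_mul_add {a b c d : ℝ≥0∞} (hab : a ≤ b) (hcd : c ≤ d) :
    a * d + b * c ≤ a * c + b * d := by
  obtain ⟨e, rfl⟩ := exists_add_of_le hcd
  calc a * (c + e) + b * c = a * c + (b * c + a * e) := by ring
    _ ≤ a * c + (b * c + b * e) := by gcongr
    _ = _ := by ring

/-- Chebyshev's inequality for two nondecreasing functions. -/
lemma lintegral_mul_le_of_monotoneOn {S : Set ℝ} (hS : MeasurableSet S) {k f g : ℝ → ℝ≥0∞}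
    (hk : Measurable k) (hf : Measurable f) (hg : Measurable g)
    (hfm : MonotoneOn f S) (hgm : MonotoneOn g S) :
    (∫⁻ x in S, k x * f x) * (∫⁻ x in S, k x * g x) ≤
      (∫⁻ x in S, k x) * ∫⁻ x in S, k x * (f x * g x) := by
  have h : ∀ F G : ℝ → ℝ≥0∞, Measurable F → Measurable G →
      ∫⁻ p : ℝ × ℝ in S ×ˢ S, F p.1 * G p.2 = (∫⁻ x in S, F x) * ∫⁻ x in S, G x := by
    intro F G hF hG
    rw [Measure.volume_eq_prod, ← Measure.prod_restrict]
    exact lintegral_prod_mul hF.aemeasurable hG.aemeasurable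
  -- Doubling each product and symmetrizing over pairs of points reduces the claim to the pointwise
  -- rearrangement inequality.
  have key : ∫⁻ p : ℝ × ℝ in S ×ˢ S,
        (k p.1 * f p.1 * (k p.2 * g p.2) + k p.1 * g p.1 * (k p.2 * f p.2)) ≤
      ∫⁻ p : ℝ × ℝ in S ×ˢ S,
        (k p.1 * (k p.2 * (f p.2 * g p.2)) + k p.1 * (f p.1 * g p.1) * k p.2) := by
    refine setLIntegral_mono' (hS.prod hS) fun p hp => ?_
    have : f p.1 * g p.2 + f p.2 * g p.1 ≤ f p.2 * g p.2 + f p.1 * g p.1 := by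
      rcases le_total p.1 p.2 with hle | hle
      · rw [add_comm (f p.2 * g p.2)]
        exact crossMul_add_le_mul_add (hfm hp.1 hp.2 hle) (hgm hp.1 hp.2 hle)
      · rw [add_comm (f p.1 * g p.2)]
        exact crossMul_add_le_mul_add (hfm hp.2 hp.1 hle) (hgm hp.2 hp.1 hle)
    calc _ = k p.1 * k p.2 * (f p.1 * g p.2 + f p.2 * g p.1) := by ring
      _ ≤ k p.1 * k p.2 * (f p.2 * g p.2 + f p.1 * g p.1) := by gcongr
      _ = _ := by ring
  rw [lintegral_add_left (by fun_prop), lintegral_add_left (by fun_prop),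
    h (fun x => k x * f x) (fun x => k x * g x) (by fun_prop) (by fun_prop),
    h (fun x => k x * g x) (fun x => k x * f x) (by fun_prop) (by fun_prop),
    h k (fun x => k x * (f x * g x)) (by fun_prop) (by fun_prop),
    h (fun x => k x * (f x * g x)) k (by fun_prop) (by fun_prop),
    mul_comm (∫⁻ x in S, k x * g x), mul_comm (∫⁻ x in S, k x * (f x * g x)),
    ← two_mul, ← two_mul] at key
  exact (ENNReal.mul_le_mul_iff_right (by norm_num) (by norm_num)).1 key

/-- Chebyshev's inequality for a nondecreasing and a nonincreasing function. -/
lemma lintegral_mul_le_of_antitoneOn {S : Set ℝ} (hS : MeasurableSet S) {k f g : ℝ → ℝ≥0∞}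
    (hk : Measurable k) (hf : Measurable f) (hg : Measurable g)
    (hfm : MonotoneOn f S) (hgm : AntitoneOn g S) :
    (∫⁻ x in S, k x) * (∫⁻ x in S, k x * (f x * g x)) ≤
      (∫⁻ x in S, k x * f x) * ∫⁻ x in S, k x * g x := by
  have h : ∀ F G : ℝ → ℝ≥0∞, Measurable F → Measurable G →
      ∫⁻ p : ℝ × ℝ in S ×ˢ S, F p.1 * G p.2 = (∫⁻ x in S, F x) * ∫⁻ x in S, G x := by
    intro F G hF hG
    rw [Measure.volume_eq_prod, ← Measure.prod_restrict]
    exact lintegral_prod_mul hF.aemeasurable hG.aemeasurable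
  have key : ∫⁻ p : ℝ × ℝ in S ×ˢ S,
        (k p.1 * (k p.2 * (f p.2 * g p.2)) + k p.1 * (f p.1 * g p.1) * k p.2) ≤
      ∫⁻ p : ℝ × ℝ in S ×ˢ S,
        (k p.1 * f p.1 * (k p.2 * g p.2) + k p.1 * g p.1 * (k p.2 * f p.2)) := by
    refine setLIntegral_mono' (hS.prod hS) fun p hp => ?_
    have : f p.2 * g p.2 + f p.1 * g p.1 ≤ f p.1 * g p.2 + f p.2 * g p.1 := by
      rcases le_total p.1 p.2 with hle | hle
      · rw [add_comm (f p.2 * g p.2), add_comm (f p.1 * g p.2), add_comm (f p.2 * g p.1),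
          add_comm (f p.1 * g p.1)]
        have := crossMul_add_le_mul_add (hfm hp.1 hp.2 hle) (hgm hp.1 hp.2 hle)
        rw [add_comm (f p.2 * g p.2)]
        exact this
      · rw [add_comm (f p.1 * g p.2)]
        exact crossMul_add_le_mul_add (hfm hp.2 hp.1 hle) (hgm hp.2 hp.1 hle)
    calc _ = k p.1 * k p.2 * (f p.2 * g p.2 + f p.1 * g p.1) := by ring
      _ ≤ k p.1 * k p.2 * (f p.1 * g p.2 + f p.2 * g p.1) := by gcongr
      _ = _ := by ring
  rw [lintegral_add_left (by fun_prop), lintegral_add_left (by fun_prop),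
    h (fun x => k x * f x) (fun x => k x * g x) (by fun_prop) (by fun_prop),
    h (fun x => k x * g x) (fun x => k x * f x) (by fun_prop) (by fun_prop),
    h k (fun x => k x * (f x * g x)) (by fun_prop) (by fun_prop),
    h (fun x => k x * (f x * g x)) k (by fun_prop) (by fun_prop),
    mul_comm (∫⁻ x in S, k x * g x), mul_comm (∫⁻ x in S, k x * (f x * g x)),
    ← two_mul, ← two_mul] at key
  exact (ENNReal.mul_le_mul_iff_right (by norm_num) (by norm_num)).1 key

/-- The weight that remains at the estimation error `u` after integrating out the scale. -/
def tailWeight (m κ η b u : ℝ) : ℝ≥0∞ :=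
  ∫⁻ w in Ioi 0, if κ * (u + η) ≤ w then
    ENNReal.ofReal (w ^ (m + 1) * Real.exp (b * u * w - (u ^ 2 + w ^ 2) / 2)) else 0

/-- In the rotated coordinates `u = z + c v`, `w = √(1 + c²) v` the region `A` is
`κ (u + η) ≤ w`. -/
structure HasSlope (A : Set (ℝ × ℝ)) (c κ η : ℝ) : Prop where
  measurableSet : MeasurableSet A
  mem_iff : ∀ z v : ℝ, 0 < v → ((z, v) ∈ A ↔ κ * (z + c * v + η) ≤ √(1 + c ^ 2) * v)

lemma hasSlope_univ (c : ℝ) : HasSlope univ c 0 0 :=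
  ⟨MeasurableSet.univ, fun z v hv => by simp; positivity⟩

lemma hasSlope_wedge {t c η : ℝ} (h : 0 < c + t) :
    HasSlope (wedge t η) c (√(1 + c ^ 2) / (c + t)) η := by
  refine ⟨measurableSet_wedge t η, fun z v hv => ?_⟩
  have hs : 0 < √(1 + c ^ 2) := by positivity
  rw [div_mul_eq_mul_div, div_le_iff₀ h, mul_assoc, mul_le_mul_iff_right₀ hs]
  simp only [wedge, mem_ofPred_eq]
  constructor <;> intro h <;> linarith

lemma measurable_tailWeight (m κ η b : ℝ) : Measurable (tailWeight m κ η b) := by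
  unfold tailWeight
  refine Measurable.lintegral_prod_right' (f := fun p : ℝ × ℝ => if κ * (p.1 + η) ≤ p.2 then
    ENNReal.ofReal (p.2 ^ (m + 1) * Real.exp (b * p.1 * p.2 - (p.1 ^ 2 + p.2 ^ 2) / 2)) else 0) ?_
  exact Measurable.ite (measurableSet_le (by fun_prop) (by fun_prop)) (by fun_prop) (by fun_prop)

/-- With r = √(1 + c²), the substitution u = z + cv, w = rv turns z² + v² into u² - 2(c/r)uw + w².
The factor r^(-(m+2)) comes from v^(m+1) dv. -/
lemma setLIntegral_comp_eq_tailWeight {A : Set (ℝ × ℝ)} {m c κ η : ℝ} (hA : HasSlope A c κ η)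
    {f : ℝ → ℝ≥0∞} (hf : Measurable f) :
    ∫⁻ p in A, f (p.1 + c * p.2) * ENNReal.ofReal p.2 ∂kernelMeasure m =
      ENNReal.ofReal (√(1 + c ^ 2) ^ (-(m + 2))) *
        ∫⁻ u, f u * tailWeight m κ η (c / √(1 + c ^ 2)) u := by
  set r := √(1 + c ^ 2) with hr
  have hr0 : 0 < r := by positivity
  have hr2 : r ^ 2 = 1 + c ^ 2 := Real.sq_sqrt (by positivity)
  set G : ℝ × ℝ → ℝ≥0∞ := (sampleSpace ∩ A).indicator fun p =>
    ENNReal.ofReal (p.2 ^ m * Real.exp (-(p.1 ^ 2 + p.2 ^ 2) / 2)) *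
      (f (p.1 + c * p.2) * ENNReal.ofReal p.2) with hG
  have hGm : Measurable G :=
    ((measurable_kernel m).mul ((hf.comp (by fun_prop)).mul (by fun_prop))).indicator
      (measurableSet_sampleSpace.inter hA.measurableSet)
  have h1 : ∫⁻ p in A, f (p.1 + c * p.2) * ENNReal.ofReal p.2 ∂kernelMeasure m = ∫⁻ p, G p := by
    rw [← lintegral_indicator hA.measurableSet, lintegral_kernelMeasure, hG,
      ← lintegral_indicator measurableSet_sampleSpace]
    refine lintegral_congr fun p => ?_
    by_cases h1 : p ∈ sampleSpace <;> by_cases h2 : p ∈ A <;> simp [h1, h2]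
  have h2 : ∫⁻ p, G p = ∫⁻ u, ∫⁻ v, G (u - c * v, v) := by
    rw [Measure.volume_eq_prod, lintegral_prod_symm' _ hGm]
    have : ∀ v, ∫⁻ z, G (z, v) = ∫⁻ u, G (u - c * v, v) := fun v =>
      (lintegral_sub_right_eq_self (fun z => G (z, v)) (c * v)).symm
    simp_rw [this]
    exact lintegral_lintegral_swap (hGm.comp (by fun_prop)).aemeasurable
  have h3 : ∀ u, ∫⁻ v, G (u - c * v, v) = ENNReal.ofReal (r ^ (-(m + 2))) *
      (f u * tailWeight m κ η (c / r) u) := by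
    intro u
    have hsc := lintegral_comp_mul_left (inv_ne_zero hr0.ne') fun v => G (u - c * v, v)
    rw [inv_inv, abs_of_pos hr0] at hsc
    have hne : ENNReal.ofReal r ≠ 0 := by simpa using hr0
    have hpt : ∀ w, G (u - c * (r⁻¹ * w), r⁻¹ * w) = ENNReal.ofReal (r ^ (-(m + 1))) * (f u *
        (Ioi (0 : ℝ)).indicator (fun w => if κ * (u + η) ≤ w then ENNReal.ofReal
          (w ^ (m + 1) * Real.exp (c / r * u * w - (u ^ 2 + w ^ 2) / 2)) else 0) w) := by
      intro w
      by_cases hw : 0 < w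
      · have hv : 0 < r⁻¹ * w := by positivity
        have hmem : (u - c * (r⁻¹ * w), r⁻¹ * w) ∈ sampleSpace ∩ A ↔ κ * (u + η) ≤ w := by
          rw [mem_inter_iff, hA.mem_iff _ _ hv, ← hr, mul_inv_cancel_left₀ hr0.ne',
            sub_add_cancel]
          exact and_iff_right hv
        have hcw : w ∈ Ioi (0 : ℝ) := hw
        rw [indicator_of_mem hcw]
        by_cases hk : κ * (u + η) ≤ w
        · rw [hG, indicator_of_mem (hmem.2 hk), if_pos hk]
          simp only [sub_add_cancel]
          have hexp : -((u - c * (r⁻¹ * w)) ^ 2 + (r⁻¹ * w) ^ 2) / 2 =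
              c / r * u * w - (u ^ 2 + w ^ 2) / 2 := by
            field_simp
            linear_combination (w ^ 2) * hr2
          rw [hexp, mul_left_comm, ← ENNReal.ofReal_mul (by positivity),
            mul_left_comm (ENNReal.ofReal (r ^ (-(m + 1)))), ← ENNReal.ofReal_mul (by positivity)]
          congr 2
          rw [Real.mul_rpow (by positivity) hw.le, Real.rpow_add_one hw.ne', Real.rpow_neg hr0.le,
            Real.rpow_add_one hr0.ne', Real.inv_rpow hr0.le]
          field_simp
        · rw [hG, indicator_of_notMem (fun h => hk (hmem.1 h)), if_neg hk]
          simp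
      · have hcw : w ∉ Ioi (0 : ℝ) := hw
        rw [indicator_of_notMem hcw, hG, indicator_of_notMem]
        · simp
        · rintro ⟨h, -⟩
          have h : 0 < r⁻¹ * w := h
          exact hw (by simpa [hr0] using h)
    simp_rw [hpt] at hsc
    rw [lintegral_const_mul' _ _ ENNReal.ofReal_ne_top, lintegral_const_mul _ ?_,
      lintegral_indicator measurableSet_Ioi] at hsc
    · change _ * (f u * tailWeight m κ η (c / r) u) = _ at hsc
      rw [← ENNReal.mul_right_inj hne ENNReal.ofReal_ne_top, ← hsc,
        ← mul_assoc (ENNReal.ofReal r), ← ENNReal.ofReal_mul hr0.le]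
      congr 2
      rw [mul_comm, ← Real.rpow_add_one hr0.ne']
      congr 1; ring
    · exact (Measurable.ite (measurableSet_le (by fun_prop) (by fun_prop)) (by fun_prop)
        (by fun_prop)).indicator measurableSet_Ioi
  rw [h1, h2]
  simp_rw [h3]
  rw [lintegral_const_mul' _ _ ENNReal.ofReal_ne_top]

end

/-! ### Pointwise comparison and reflection of the tail weights -/

section

variable {ρ q : ℝ → ℝ} {m c c' t η κ κ' b b' u l : ℝ} {A B : Set (ℝ × ℝ)}

lemma overPart_eq (hq : IsSubderivative ρ q) (hA : HasSlope A c κ η) :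
    overPart q m A c = ENNReal.ofReal (√(1 + c ^ 2) ^ (-(m + 2))) *
      ∫⁻ u, ENNReal.ofReal (q u) * tailWeight m κ η (c / √(1 + c ^ 2)) u := by
  rw [← setLIntegral_comp_eq_tailWeight hA (f := fun u => ENNReal.ofReal (q u))
    hq.measurable.ennreal_ofReal]
  refine lintegral_congr_ae ?_
  filter_upwards [ae_restrict_of_ae (ae_kernelMeasure_snd_pos m)] with p hp
  exact ENNReal.ofReal_mul' hp.le

lemma underPart_eq (hq : IsSubderivative ρ q) (hA : HasSlope A c κ η) :
    underPart q m A c = ENNReal.ofReal (√(1 + c ^ 2) ^ (-(m + 2))) *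
      ∫⁻ u, ENNReal.ofReal (-q u) * tailWeight m κ η (c / √(1 + c ^ 2)) u := by
  rw [← setLIntegral_comp_eq_tailWeight hA (f := fun u => ENNReal.ofReal (-q u))
    hq.measurable.neg.ennreal_ofReal]
  refine lintegral_congr_ae ?_
  filter_upwards [ae_restrict_of_ae (ae_kernelMeasure_snd_pos m)] with p hp
  exact ENNReal.ofReal_mul' hp.le

lemma slope_const_ne_zero (m c : ℝ) : ENNReal.ofReal (√(1 + c ^ 2) ^ (-(m + 2))) ≠ 0 := by
  simp only [ne_eq, ENNReal.ofReal_eq_zero, not_le]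
  have : 0 < √(1 + c ^ 2) := by positivity
  positivity

lemma overPart_le_underPart_iff (hq : IsSubderivative ρ q) (hA : HasSlope A c κ η) :
    overPart q m A c ≤ underPart q m A c ↔
      ∫⁻ u, ENNReal.ofReal (q u) * tailWeight m κ η (c / √(1 + c ^ 2)) u ≤
        ∫⁻ u, ENNReal.ofReal (-q u) * tailWeight m κ η (c / √(1 + c ^ 2)) u := by
  rw [overPart_eq hq hA, underPart_eq hq hA]
  exact ENNReal.mul_le_mul_iff_right (slope_const_ne_zero m c) ENNReal.ofReal_ne_top

lemma underPart_le_overPart_iff (hq : IsSubderivative ρ q) (hA : HasSlope A c κ η) :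
    underPart q m A c ≤ overPart q m A c ↔
      ∫⁻ u, ENNReal.ofReal (-q u) * tailWeight m κ η (c / √(1 + c ^ 2)) u ≤
        ∫⁻ u, ENNReal.ofReal (q u) * tailWeight m κ η (c / √(1 + c ^ 2)) u := by
  rw [overPart_eq hq hA, underPart_eq hq hA]
  exact ENNReal.mul_le_mul_iff_right (slope_const_ne_zero m c) ENNReal.ofReal_ne_top

lemma tailWeight_mono (hb : b ≤ b') (hκ : κ' ≤ κ) (hu : 0 ≤ u) :
    tailWeight m κ 0 b u ≤ tailWeight m κ' 0 b' u := by
  refine setLIntegral_mono' measurableSet_Ioi fun w hw => ?_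
  have hw : 0 < w := hw
  by_cases h : κ * (u + 0) ≤ w
  · have h' : κ' * (u + 0) ≤ w := le_trans (by gcongr) h
    rw [if_pos h, if_pos h']
    gcongr
  · rw [if_neg h]; exact zero_le

/-- For u ≤ 0 the cutoff with slope `κ` is vacuous, so only the factor exp(buw) matters. -/
lemma tailWeight_anti (hb : b ≤ b') (hκ0 : 0 ≤ κ) (hu : u ≤ 0) :
    tailWeight m κ' 0 b' u ≤ tailWeight m κ 0 b u := by
  refine setLIntegral_mono' measurableSet_Ioi fun w hw => ?_
  have hw : 0 < w := hw
  have h : κ * (u + 0) ≤ w := by nlinarith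
  rw [if_pos h]
  split_ifs
  · refine ENNReal.ofReal_le_ofReal ?_
    have : b' * u * w ≤ b * u * w := by
      have := mul_le_mul_of_nonpos_right hb hu
      gcongr
    gcongr
  · exact zero_le

/-- Once over-estimation prevails, it still does after the coordinates are tilted towards
over-estimation. -/
lemma overPart_tilt (hq : IsSubderivative ρ q) (hA : HasSlope A c κ 0) (hB : HasSlope B c' κ' 0)
    (hb : c / √(1 + c ^ 2) ≤ c' / √(1 + c' ^ 2)) (hκ0 : 0 ≤ κ) (hκ : κ' ≤ κ)
    (hover : underPart q m A c < overPart q m A c) : underPart q m B c' ≤ overPart q m B c' := by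
  rw [underPart_le_overPart_iff hq hB]
  have h := (underPart_le_overPart_iff hq hA).1 hover.le
  refine le_trans (lintegral_mono fun u => ?_) (h.trans (lintegral_mono fun u => ?_))
  · rcases le_total 0 u with hu | hu
    · rw [ENNReal.ofReal_of_nonpos (neg_nonpos.2 (hq.nonneg hu)), zero_mul]; exact zero_le
    · gcongr; exact tailWeight_anti hb hκ0 hu
  · rcases le_total 0 u with hu | hu
    · gcongr; exact tailWeight_mono hb hκ hu
    · rw [ENNReal.ofReal_of_nonpos (hq.nonpos hu), zero_mul]; exact zero_le

/-- The translation w = x + 2bu carries the exponent at error u to the exponent at error -u and only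
enlarges the power factor. The condition κ ≤ 2b keeps the translated points beyond the cutoff. -/
lemma tailWeight_neg_le (hm : 0 ≤ m) (hb : 0 ≤ b) (hκ : κ ≤ 2 * b) (hu : 0 ≤ u) :
    tailWeight m κ 0 b (-u) ≤ tailWeight m κ 0 b u := by
  set F : ℝ → ℝ≥0∞ := (Ioi (0 : ℝ)).indicator fun w => if κ * (u + 0) ≤ w then
    ENNReal.ofReal (w ^ (m + 1) * Real.exp (b * u * w - (u ^ 2 + w ^ 2) / 2)) else 0 with hF
  have h1 : tailWeight m κ 0 b u = ∫⁻ x, F (x + 2 * b * u) := by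
    rw [lintegral_add_right_eq_self, hF, lintegral_indicator measurableSet_Ioi]; rfl
  rw [h1]
  refine le_trans ?_ (setLIntegral_le_lintegral (Ioi (0 : ℝ)) _)
  refine setLIntegral_mono' measurableSet_Ioi fun x hx => ?_
  have hx : 0 < x := hx
  have hbu : 0 ≤ 2 * b * u := by positivity
  have hmem : x + 2 * b * u ∈ Ioi (0 : ℝ) := by
    have : 0 < x + 2 * b * u := by linarith
    exact this
  have hle : κ * (u + 0) ≤ x + 2 * b * u := by nlinarith
  rw [hF, indicator_of_mem hmem, if_pos hle]
  split_ifs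
  · refine ENNReal.ofReal_le_ofReal ?_
    have hexp : b * u * (x + 2 * b * u) - (u ^ 2 + (x + 2 * b * u) ^ 2) / 2 =
      b * -u * x - ((-u) ^ 2 + x ^ 2) / 2 := by ring
    rw [hexp]
    gcongr
    linarith
  · exact zero_le

/-- The errors u and -u are paired: over-estimation has both the steeper loss and the larger weight.
-/
lemma underPart_le_overPart_of_penalizes (hq : IsSubderivative ρ q) (hm : 0 ≤ m)
    (hpen : ∀ᵐ u : ℝ, 0 < u → -q (-u) ≤ q u) (hc : 0 < c) (ht : 1 ≤ c ^ 2 + 2 * c * t) :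
    underPart q m (wedge t 0) c ≤ overPart q m (wedge t 0) c := by
  have hct : 0 < c + t := by nlinarith
  have hA := hasSlope_wedge (η := 0) hct
  rw [underPart_le_overPart_iff hq hA]
  set b := c / √(1 + c ^ 2)
  set κ := √(1 + c ^ 2) / (c + t) with hκdef
  have hs : 0 < √(1 + c ^ 2) := by positivity
  have hs2 : √(1 + c ^ 2) * √(1 + c ^ 2) = 1 + c ^ 2 := Real.mul_self_sqrt (by positivity)
  have hb : 0 ≤ b := by positivity
  -- After clearing denominators this is 1 + c² ≤ 2c(c + t), that is, `ht`.
  have hκ : κ ≤ 2 * b := by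
    rw [hκdef, mul_div_assoc', div_le_div_iff₀ hct hs]
    nlinarith
  rw [← lintegral_neg_eq_self fun u => ENNReal.ofReal (-q u) * tailWeight m κ 0 b u]
  refine lintegral_mono_ae ?_
  filter_upwards [hpen] with u hu
  rcases le_or_gt u 0 with h | h
  · rw [ENNReal.ofReal_of_nonpos (neg_nonpos.2 (hq.nonneg (by linarith))), zero_mul]; exact zero_le
  · exact mul_le_mul' (ENNReal.ofReal_le_ofReal (hu h)) (tailWeight_neg_le hm hb hκ h.le)

/-- The ratio V/W is at most β/α where `f` lives and at least β/α where `g` lives. Below, β/α is the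
ratio of the two tail weights at error 0. -/
lemma lintegral_le_of_weight_le {f g W V : ℝ → ℝ≥0∞} {α β : ℝ≥0∞} (hα0 : α ≠ 0) (hα : α ≠ ∞)
    (hβ : β ≠ ∞) (hf : ∀ u, f u * (V u * α) ≤ f u * (β * W u))
    (hg : ∀ u, g u * (β * W u) ≤ g u * (V u * α))
    (h : ∫⁻ u, f u * W u ≤ ∫⁻ u, g u * W u) : ∫⁻ u, f u * V u ≤ ∫⁻ u, g u * V u := by
  refine (ENNReal.mul_le_mul_iff_right hα0 hα).1 ?_
  calc α * ∫⁻ u, f u * V u = ∫⁻ u, f u * (V u * α) := by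
        rw [← lintegral_const_mul' _ _ hα]; exact lintegral_congr fun u => by ring
    _ ≤ ∫⁻ u, f u * (β * W u) := lintegral_mono hf
    _ = β * ∫⁻ u, f u * W u := by
        rw [← lintegral_const_mul' _ _ hβ]; exact lintegral_congr fun u => by ring
    _ ≤ β * ∫⁻ u, g u * W u := by gcongr
    _ = ∫⁻ u, g u * (β * W u) := by
        rw [← lintegral_const_mul' _ _ hβ]; exact lintegral_congr fun u => by ring
    _ ≤ ∫⁻ u, g u * (V u * α) := lintegral_mono hg
    _ = α * ∫⁻ u, g u * V u := by
        rw [← lintegral_const_mul' _ _ hα]; exact lintegral_congr fun u => by ring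

lemma tailWeight_ne_top (hm : 0 ≤ m) : tailWeight m κ η b u ≠ ∞ := by
  have hint := (integrableOn_rpow_mul_exp_neg_mul_sq (b := 1 / 4) (by norm_num)
    (s := m + 1) (by linarith)).const_mul (Real.exp (b ^ 2 * u ^ 2))
  refine ne_top_of_le_ne_top hint.lintegral_lt_top.ne ?_
  refine setLIntegral_mono' measurableSet_Ioi fun w hw => ?_
  have hw : 0 < w := hw
  split_ifs
  · refine ENNReal.ofReal_le_ofReal ?_
    rw [mul_left_comm, ← Real.exp_add]
    gcongr
    nlinarith [sq_nonneg (b * u - w / 2), sq_nonneg u]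
  · exact zero_le

lemma tailWeight_pos : 0 < tailWeight m κ η b u := by
  unfold tailWeight
  rw [pos_iff_ne_zero, ne_eq, lintegral_eq_zero_iff' ?_]
  · intro h0
    have h1 : volume (Ioi (max 0 (κ * (u + η)))) = 0 := by
      refine measure_mono_null (fun w hw => ?_)
        (ae_iff.1 ((ae_restrict_iff' measurableSet_Ioi).1 h0))
      have hw1 : 0 < w := lt_of_le_of_lt (le_max_left _ _) hw
      have hw2 : κ * (u + η) ≤ w := (lt_of_le_of_lt (le_max_right _ _) hw).le
      simp only [mem_ofPred_eq, Classical.not_imp]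
      refine ⟨hw1, ?_⟩
      rw [if_pos hw2]
      simp only [Pi.zero_apply, ENNReal.ofReal_eq_zero, not_le]
      positivity
    simp at h1
  · exact (Measurable.ite (measurableSet_le (by fun_prop) (by fun_prop)) (by fun_prop)
        (by fun_prop)).aemeasurable

end

/-! ### Chebyshev comparisons: shifting η and raising the power of the scale -/

section

variable {ρ q : ℝ → ℝ} {m c c' t η κ κ' b b' u l : ℝ} {A B : Set (ℝ × ℝ)}

/-- The weight of the shifted scale `x` at the estimation error `0`. -/
def shiftKernel (m κ x : ℝ) : ℝ≥0∞ :=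
  ENNReal.ofReal ((κ * x) ^ (m + 1) * Real.exp (-(κ * x) ^ 2 / 2))

/-- The relative weight of the shifted scale `x` at the estimation error `u`. -/
def shiftRatio (m κ b u x : ℝ) : ℝ≥0∞ :=
  ENNReal.ofReal ((max (u + x) 0 / x) ^ (m + 1) * Real.exp (-(κ * (κ - b) * u * x)))

lemma measurable_shiftKernel (m κ : ℝ) : Measurable (shiftKernel m κ) := by
  unfold shiftKernel; fun_prop

lemma measurable_shiftRatio (m κ b u : ℝ) : Measurable (shiftRatio m κ b u) := by
  unfold shiftRatio; fun_prop

/-- The substitution w = κ(x + u) makes the cutoff x ≥ η independent of the error u. All dependence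
on u is then in a prefactor and in `shiftRatio`, which equals 1 at u = 0 for x > 0. -/
lemma tailWeight_eq_lintegral_shift (hm : 0 ≤ m) (hκ : 0 < κ) (hη : 0 ≤ η) (b u : ℝ) :
    tailWeight m κ η b u = ENNReal.ofReal (κ * Real.exp ((b * κ - κ ^ 2 / 2 - 1 / 2) * u ^ 2)) *
      ∫⁻ x in Ioi 0, shiftKernel m κ x *
        ((if η ≤ x then 1 else 0) * shiftRatio m κ b u x) := by
  unfold shiftKernel shiftRatio
  set F : ℝ → ℝ≥0∞ := (Ioi (0 : ℝ)).indicator fun w => if κ * (u + η) ≤ w then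
    ENNReal.ofReal (w ^ (m + 1) * Real.exp (b * u * w - (u ^ 2 + w ^ 2) / 2)) else 0 with hF
  have h1 : tailWeight m κ η b u = ENNReal.ofReal κ * ∫⁻ x, F (κ * (x + u)) := by
    rw [lintegral_add_right_eq_self (fun y => F (κ * y)) u, lintegral_comp_mul_left hκ.ne',
      ← mul_assoc, ← ENNReal.ofReal_mul hκ.le, abs_of_pos (inv_pos.2 hκ),
      mul_inv_cancel₀ hκ.ne', ENNReal.ofReal_one, one_mul, hF,
      lintegral_indicator measurableSet_Ioi]
    rfl
  rw [h1, ENNReal.ofReal_mul hκ.le, mul_assoc]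
  congr 1
  rw [← lintegral_const_mul' _ _ ENNReal.ofReal_ne_top, ← lintegral_indicator measurableSet_Ioi]
  refine lintegral_congr_ae ?_
  filter_upwards [compl_mem_ae_iff.2 (measure_singleton (0 : ℝ))] with x hx0
  have hx0 : x ≠ 0 := hx0
  rcases lt_or_gt_of_ne hx0 with hx | hx
  · have hnx : x ∉ Ioi (0 : ℝ) := by simpa using hx.le
    have hcond : ¬ κ * (u + η) ≤ κ * (x + u) := by
      rw [mul_le_mul_iff_right₀ hκ]; linarith
    rw [indicator_of_notMem hnx]
    simp only [hF, indicator_apply, if_neg hcond, ite_self]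
  · have hmx : x ∈ Ioi (0 : ℝ) := hx
    have hcond : κ * (u + η) ≤ κ * (x + u) ↔ η ≤ x := by
      rw [mul_le_mul_iff_right₀ hκ]; constructor <;> intro h <;> linarith
    rw [indicator_of_mem hmx]
    by_cases hxu : 0 < x + u
    · have hmem : κ * (x + u) ∈ Ioi (0 : ℝ) := mul_pos hκ hxu
      rw [hF, indicator_of_mem hmem]
      by_cases hηx : η ≤ x
      · rw [if_pos (hcond.2 hηx), if_pos hηx, one_mul, max_eq_left (by linarith),
          ← ENNReal.ofReal_mul (by positivity), ← ENNReal.ofReal_mul (by positivity)]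
        congr 1
        have hexp : b * u * (κ * (x + u)) - (u ^ 2 + (κ * (x + u)) ^ 2) / 2 =
          (b * κ - κ ^ 2 / 2 - 1 / 2) * u ^ 2 + -(κ * x) ^ 2 / 2 + -(κ * (κ - b) * u * x) := by
          ring
        have hpow : (κ * (x + u)) ^ (m + 1) = (κ * x) ^ (m + 1) * ((u + x) / x) ^ (m + 1) := by
          rw [← Real.mul_rpow (by positivity) (div_nonneg (by linarith) hx.le)]
          congr 1; field_simp; ring
        rw [hexp, Real.exp_add, Real.exp_add, hpow]
        ring
      · rw [if_neg (fun h => hηx (hcond.1 h)), if_neg hηx]; simp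
    · have hnmem : κ * (x + u) ∉ Ioi (0 : ℝ) := by
        have : κ * (x + u) ≤ 0 := mul_nonpos_of_nonneg_of_nonpos hκ.le (not_lt.1 hxu)
        simpa using this
      rw [hF, indicator_of_notMem hnmem, max_eq_right (by linarith), zero_div,
        Real.zero_rpow (by linarith)]
      simp

lemma tailWeight_eq_lintegral_shift_zero (hm : 0 ≤ m) (hκ : 0 < κ) (b u : ℝ) :
    tailWeight m κ 0 b u = ENNReal.ofReal (κ * Real.exp ((b * κ - κ ^ 2 / 2 - 1 / 2) * u ^ 2)) *
      ∫⁻ x in Ioi 0, shiftKernel m κ x * shiftRatio m κ b u x := by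
  rw [tailWeight_eq_lintegral_shift hm hκ le_rfl]
  congr 1
  refine setLIntegral_congr_fun measurableSet_Ioi fun x hx => ?_
  have hx : (0 : ℝ) < x := hx
  simp [hx.le]

lemma tailWeight_zero_eq_lintegral_shift (hm : 0 ≤ m) (hκ : 0 < κ) (hη : 0 ≤ η) (b : ℝ) :
    tailWeight m κ η b 0 = ENNReal.ofReal κ *
      ∫⁻ x in Ioi 0, shiftKernel m κ x * (if η ≤ x then 1 else 0) := by
  rw [tailWeight_eq_lintegral_shift hm hκ hη]
  congr 1
  · simp
  · refine setLIntegral_congr_fun measurableSet_Ioi fun x hx => ?_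
    have hx : 0 < x := hx
    simp [shiftRatio, max_eq_left hx.le, hx.ne']

lemma tailWeight_zero_zero_eq_lintegral_shift (hm : 0 ≤ m) (hκ : 0 < κ) (b : ℝ) :
    tailWeight m κ 0 b 0 = ENNReal.ofReal κ * ∫⁻ x in Ioi 0, shiftKernel m κ x := by
  rw [tailWeight_zero_eq_lintegral_shift hm hκ le_rfl]
  congr 1
  refine setLIntegral_congr_fun measurableSet_Ioi fun x hx => ?_
  have hx : (0 : ℝ) < x := hx
  simp [hx.le]

lemma measurable_threshold (η : ℝ) : Measurable fun x : ℝ => if η ≤ x then (1 : ℝ≥0∞) else 0 :=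
  Measurable.ite measurableSet_Ici measurable_const measurable_const

lemma monotone_threshold (η : ℝ) : Monotone fun x : ℝ => if η ≤ x then (1 : ℝ≥0∞) else 0 := by
  intro x y hxy
  by_cases h : η ≤ x
  · simp [h, h.trans hxy]
  · simp [h]

/-- For u ≥ 0 and b ≤ κ both factors of `shiftRatio` decrease in x, while the threshold x ≥ η
increases, so Chebyshev's inequality applies. For u ≤ 0 the ratio increases and the comparison
reverses. -/
lemma tailWeight_shift_le (hm : 0 ≤ m) (hκ : 0 < κ) (hη : 0 ≤ η) (hb : b ≤ κ) (hu : 0 ≤ u) :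
    tailWeight m κ η b u * tailWeight m κ 0 b 0 ≤
      tailWeight m κ η b 0 * tailWeight m κ 0 b u := by
  have hcheb := lintegral_mul_le_of_antitoneOn (S := Ioi 0) measurableSet_Ioi
    (measurable_shiftKernel m κ) (measurable_threshold η) (measurable_shiftRatio m κ b u)
    ((monotone_threshold η).monotoneOn _) ?_
  · rw [tailWeight_zero_eq_lintegral_shift hm hκ hη, tailWeight_zero_zero_eq_lintegral_shift hm hκ,
      tailWeight_eq_lintegral_shift hm hκ hη, tailWeight_eq_lintegral_shift_zero hm hκ,
      mul_comm (_ * _) (ENNReal.ofReal κ * _)]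
    exact (mul_mul_mul_comm _ _ _ _).trans_le
      ((mul_le_mul_right hcheb _).trans_eq (mul_mul_mul_comm _ _ _ _))
  · intro x hx y hy hxy
    have hx : 0 < x := hx
    have hy : 0 < y := hy
    refine ENNReal.ofReal_le_ofReal ?_
    have h1 : max (u + y) 0 / y ≤ max (u + x) 0 / x := by
      rw [max_eq_left (by linarith), max_eq_left (by linarith), div_le_div_iff₀ hy hx]
      nlinarith
    have h2 : 0 ≤ κ * (κ - b) * u := by
      have := sub_nonneg.2 hb
      positivity
    gcongr

lemma le_tailWeight_shift (hm : 0 ≤ m) (hκ : 0 < κ) (hη : 0 ≤ η) (hb : b ≤ κ) (hu : u ≤ 0) :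
    tailWeight m κ η b 0 * tailWeight m κ 0 b u ≤
      tailWeight m κ η b u * tailWeight m κ 0 b 0 := by
  have hcheb := lintegral_mul_le_of_monotoneOn (S := Ioi 0) measurableSet_Ioi
    (measurable_shiftKernel m κ) (measurable_threshold η) (measurable_shiftRatio m κ b u)
    ((monotone_threshold η).monotoneOn _) ?_
  · rw [tailWeight_zero_eq_lintegral_shift hm hκ hη, tailWeight_zero_zero_eq_lintegral_shift hm hκ,
      tailWeight_eq_lintegral_shift hm hκ hη, tailWeight_eq_lintegral_shift_zero hm hκ,
      mul_comm (_ * _) (ENNReal.ofReal κ * lintegral _ (shiftKernel m κ))]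
    exact (mul_mul_mul_comm _ _ _ _).trans_le
      ((mul_le_mul_right hcheb _).trans_eq (mul_mul_mul_comm _ _ _ _))
  · intro x hx y hy hxy
    have hx : 0 < x := hx
    have hy : 0 < y := hy
    refine ENNReal.ofReal_le_ofReal ?_
    have h1 : max (u + x) 0 / x ≤ max (u + y) 0 / y := by
      rw [div_le_div_iff₀ hx hy]
      rcases le_total (u + x) 0 with h | h
      · rw [max_eq_right h, zero_mul]; positivity
      · rw [max_eq_left h, max_eq_left (by linarith)]; nlinarith
    have h2 : κ * (κ - b) * u ≤ 0 :=
      mul_nonpos_of_nonneg_of_nonpos (mul_nonneg hκ.le (sub_nonneg.2 hb)) hu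
    have h3 : κ * (κ - b) * u * y ≤ κ * (κ - b) * u * x := by nlinarith
    gcongr

lemma tailWeight_power (l b u κ m : ℝ) :
    tailWeight (m + l) κ 0 b u = ENNReal.ofReal (Real.exp (-u ^ 2 / 2)) *
      ∫⁻ w in Ioi 0, ENNReal.ofReal (w ^ (m + 1) * Real.exp (-w ^ 2 / 2)) *
        (ENNReal.ofReal (w ^ l) * ((if κ * u ≤ w then 1 else 0) *
          ENNReal.ofReal (Real.exp (b * u * w)))) := by
  rw [← lintegral_const_mul' _ _ ENNReal.ofReal_ne_top]
  refine setLIntegral_congr_fun measurableSet_Ioi fun w hw => ?_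
  have hw : 0 < w := hw
  simp only [add_zero]
  split_ifs
  · rw [one_mul, ← ENNReal.ofReal_mul (by positivity), ← ENNReal.ofReal_mul (by positivity),
      ← ENNReal.ofReal_mul (by positivity)]
    congr 1
    have hexp : b * u * w - (u ^ 2 + w ^ 2) / 2 = -u ^ 2 / 2 + -w ^ 2 / 2 + b * u * w := by ring
    rw [hexp, Real.exp_add, Real.exp_add, add_right_comm, Real.rpow_add hw]
    ring
  · simp

lemma tailWeight_no_power (b u κ m : ℝ) :
    tailWeight m κ 0 b u = ENNReal.ofReal (Real.exp (-u ^ 2 / 2)) *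
      ∫⁻ w in Ioi 0, ENNReal.ofReal (w ^ (m + 1) * Real.exp (-w ^ 2 / 2)) *
        ((if κ * u ≤ w then 1 else 0) * ENNReal.ofReal (Real.exp (b * u * w))) := by
  have := tailWeight_power 0 b u κ m
  simpa using this

lemma tailWeight_power_zero (l b κ m : ℝ) :
    tailWeight (m + l) κ 0 b 0 =
      ∫⁻ w in Ioi 0, ENNReal.ofReal (w ^ (m + 1) * Real.exp (-w ^ 2 / 2)) *
        ENNReal.ofReal (w ^ l) := by
  rw [tailWeight_power]
  simp only [ne_eq, OfNat.ofNat_ne_zero, not_false_eq_true, zero_pow, neg_zero, zero_div,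
    Real.exp_zero, ENNReal.ofReal_one, one_mul, mul_zero, zero_mul, mul_one]
  refine setLIntegral_congr_fun measurableSet_Ioi fun x hx => ?_
  have hx : (0 : ℝ) < x := hx
  simp [hx.le]

lemma tailWeight_no_power_zero (b κ m : ℝ) :
    tailWeight m κ 0 b 0 =
      ∫⁻ w in Ioi 0, ENNReal.ofReal (w ^ (m + 1) * Real.exp (-w ^ 2 / 2)) := by
  have := tailWeight_power_zero 0 b κ m
  simpa using this

/-- For u ≥ 0 both the cutoff and exp(buw) increase in w, as does w^l. For u ≤ 0 the cutoff is
vacuous and the exponential decreases, which gives the opposite comparison. -/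
lemma le_tailWeight_power (hl : 0 ≤ l) (hb : 0 ≤ b) (hu : 0 ≤ u) :
    tailWeight (m + l) κ 0 b 0 * tailWeight m κ 0 b u ≤
      tailWeight (m + l) κ 0 b u * tailWeight m κ 0 b 0 := by
  have hcheb := lintegral_mul_le_of_monotoneOn (S := Ioi 0) measurableSet_Ioi
    (k := fun w => ENNReal.ofReal (w ^ (m + 1) * Real.exp (-w ^ 2 / 2)))
    (f := fun w => ENNReal.ofReal (w ^ l))
    (g := fun w => (if κ * u ≤ w then 1 else 0) * ENNReal.ofReal (Real.exp (b * u * w)))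
    (by fun_prop) (by fun_prop) ((measurable_threshold _).mul (by fun_prop)) ?_ ?_
  · rw [tailWeight_power_zero, tailWeight_no_power_zero, tailWeight_power,
      tailWeight_no_power, mul_left_comm, mul_assoc]
    refine mul_le_mul_right (hcheb.trans_eq (mul_comm _ _)) _
  · intro x hx y _ hxy
    have hx : 0 < x := hx
    dsimp only
    gcongr
  · intro x hx y _ hxy
    refine mul_le_mul' (monotone_threshold _ hxy) (ENNReal.ofReal_le_ofReal ?_)
    gcongr

lemma tailWeight_power_le (hl : 0 ≤ l) (hκ : 0 ≤ κ) (hb : 0 ≤ b) (hu : u ≤ 0) :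
    tailWeight (m + l) κ 0 b u * tailWeight m κ 0 b 0 ≤
      tailWeight (m + l) κ 0 b 0 * tailWeight m κ 0 b u := by
  have hcheb := lintegral_mul_le_of_antitoneOn (S := Ioi 0) measurableSet_Ioi
    (k := fun w => ENNReal.ofReal (w ^ (m + 1) * Real.exp (-w ^ 2 / 2)))
    (f := fun w => ENNReal.ofReal (w ^ l))
    (g := fun w => (if κ * u ≤ w then 1 else 0) * ENNReal.ofReal (Real.exp (b * u * w)))
    (by fun_prop) (by fun_prop) ((measurable_threshold _).mul (by fun_prop)) ?_ ?_
  · rw [tailWeight_power_zero, tailWeight_no_power_zero, tailWeight_power,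
      tailWeight_no_power, mul_left_comm, mul_assoc]
    refine mul_le_mul_right ((mul_comm _ _).trans_le hcheb) _
  · intro x hx y _ hxy
    have hx : 0 < x := hx
    dsimp only
    gcongr
  · intro x hx y hy hxy
    have hx : 0 < x := hx
    have hy : 0 < y := hy
    have h1 : κ * u ≤ x := by nlinarith
    have h2 : κ * u ≤ y := by nlinarith
    simp only [if_pos h1, if_pos h2, one_mul]
    refine ENNReal.ofReal_le_ofReal (Real.exp_le_exp.2 ?_)
    exact mul_le_mul_of_nonpos_left hxy (mul_nonpos_of_nonneg_of_nonpos hb hu)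

/-- If over-estimation prevails with the scale weight `v ^ m`, then it does with `v ^ (m + l)`. -/
lemma underPart_le_overPart_power (hq : IsSubderivative ρ q) (hA : HasSlope A c κ 0) (hm : 0 ≤ m)
    (hl : 0 ≤ l) (hκ : 0 ≤ κ) (hc : 0 ≤ c) (h : underPart q m A c ≤ overPart q m A c) :
    underPart q (m + l) A c ≤ overPart q (m + l) A c := by
  rw [underPart_le_overPart_iff hq hA] at h ⊢
  have hb : 0 ≤ c / √(1 + c ^ 2) := by positivity
  set b := c / √(1 + c ^ 2)
  refine lintegral_le_of_weight_le (α := tailWeight m κ 0 b 0) (β := tailWeight (m + l) κ 0 b 0)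
    tailWeight_pos.ne' (tailWeight_ne_top hm) (tailWeight_ne_top (by positivity)) ?_ ?_ h
  · intro u
    rcases le_total 0 u with hu | hu
    · rw [ENNReal.ofReal_of_nonpos (neg_nonpos.2 (hq.nonneg hu)), zero_mul]; exact zero_le
    · exact mul_le_mul_right (tailWeight_power_le hl hκ hb hu) _
  · intro u
    rcases le_total 0 u with hu | hu
    · exact mul_le_mul_right (le_tailWeight_power hl hb hu) _
    · rw [ENNReal.ofReal_of_nonpos (hq.nonpos hu), zero_mul]; exact zero_le

/-- This is the condition b ≤ κ that makes `shiftRatio` monotone. -/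
lemma div_sqrt_le_sqrt_div (hct : 0 < c + t) (hle : c * t ≤ 1) :
    c / √(1 + c ^ 2) ≤ √(1 + c ^ 2) / (c + t) := by
  have hs : 0 < √(1 + c ^ 2) := by positivity
  rw [div_le_div_iff₀ hs hct, Real.mul_self_sqrt (by positivity)]
  nlinarith

/-- If under-estimation prevails for `η = 0`, then it does for `η ≥ 0`. -/
lemma overPart_le_underPart_shift (hq : IsSubderivative ρ q) (hm : 0 ≤ m) (hle : 0 < c + t → c * t ≤ 1)
    (hη : 0 ≤ η) (h : overPart q m (wedge t 0) c ≤ underPart q m (wedge t 0) c) :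
    overPart q m (wedge t η) c ≤ underPart q m (wedge t η) c := by
  rcases le_or_gt (c + t) 0 with hct | hct
  · rw [overPart_wedge_eq_zero hq hη (by linarith)]; exact zero_le
  rw [overPart_le_underPart_iff hq (hasSlope_wedge hct)] at h ⊢
  have hb := div_sqrt_le_sqrt_div hct (hle hct)
  have hκ : 0 < √(1 + c ^ 2) / (c + t) := by positivity
  set b := c / √(1 + c ^ 2)
  set κ := √(1 + c ^ 2) / (c + t)
  refine lintegral_le_of_weight_le (α := tailWeight m κ 0 b 0) (β := tailWeight m κ η b 0)
    tailWeight_pos.ne' (tailWeight_ne_top hm) (tailWeight_ne_top hm) ?_ ?_ h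
  · intro u
    rcases le_total 0 u with hu | hu
    · exact mul_le_mul_right (tailWeight_shift_le hm hκ hη hb hu) _
    · rw [ENNReal.ofReal_of_nonpos (hq.nonpos hu), zero_mul]; exact zero_le
  · intro u
    rcases le_total 0 u with hu | hu
    · rw [ENNReal.ofReal_of_nonpos (neg_nonpos.2 (hq.nonneg hu)), zero_mul]; exact zero_le
    · exact mul_le_mul_right (le_tailWeight_shift hm hκ hη hb hu) _

lemma tailWeight_lt_of_pos (hm : 0 ≤ m) (hκ : 0 < κ) (hη : 0 < η) :
    tailWeight m κ η b 0 < tailWeight m κ 0 b 0 := by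
  refine lintegral_strict_mono_of_ae_le_of_ae_lt_on (s := Ioo 0 (κ * η)) ?_
    (tailWeight_ne_top hm) ?_ ?_ ?_
  · exact (Measurable.ite (measurableSet_le (by fun_prop) (by fun_prop)) (by fun_prop)
      (by fun_prop)).aemeasurable
  · filter_upwards [ae_restrict_mem measurableSet_Ioi] with w hw
    have hw : 0 < w := hw
    rw [if_pos (show κ * (0 + 0) ≤ w by simpa using hw.le)]
    split_ifs
    · exact le_rfl
    · exact zero_le
  · rw [Measure.restrict_apply measurableSet_Ioo, inter_eq_left.2 Ioo_subset_Ioi_self]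
    simp [hκ, hη]
  · refine Eventually.of_forall fun w hw => ?_
    have hw0 : 0 < w := hw.1
    rw [if_pos (show κ * (0 + 0) ≤ w by simpa using hw0.le), if_neg (by simpa using hw.2)]
    simp only [ENNReal.ofReal_pos]
    positivity

lemma tailWeight_eq_of_lt_neg (hκ : 0 ≤ κ) (hη : 0 ≤ η) (hu : u < -η) :
    tailWeight m κ η b u = tailWeight m κ 0 b u := by
  refine setLIntegral_congr_fun measurableSet_Ioi fun w hw => ?_
  have hw : 0 < w := hw
  rw [if_pos (show κ * (u + η) ≤ w by nlinarith), if_pos (show κ * (u + 0) ≤ w by nlinarith)]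

/-- If under-estimation prevails for `η = 0`, then it does so strictly for `η > 0`. -/
lemma overPart_lt_underPart_shift (hq : IsSubderivative ρ q) (hm : 0 ≤ m) (hle : 0 < c + t → c * t ≤ 1)
    (hη : 0 < η) (h : overPart q m (wedge t 0) c ≤ underPart q m (wedge t 0) c)
    (hfin : underPart q m (wedge t η) c ≠ ∞) :
    overPart q m (wedge t η) c < underPart q m (wedge t η) c := by
  rcases le_or_gt (c + t) 0 with hct | hct
  · rw [overPart_wedge_eq_zero hq hη.le (by linarith)]; exact underPart_wedge_pos hq t η c
  have hA := hasSlope_wedge (η := 0) hct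
  have hB := hasSlope_wedge (η := η) hct
  rw [overPart_le_underPart_iff hq hA] at h
  rw [underPart_eq hq hB] at hfin
  rw [overPart_eq hq hB, underPart_eq hq hB]
  rw [ENNReal.mul_lt_mul_iff_right (slope_const_ne_zero m c) ENNReal.ofReal_ne_top]
  have hb := div_sqrt_le_sqrt_div hct (hle hct)
  have hκ : 0 < √(1 + c ^ 2) / (c + t) := by positivity
  set b := c / √(1 + c ^ 2)
  set κ := √(1 + c ^ 2) / (c + t)
  have hfin' : ∫⁻ u, ENNReal.ofReal (-q u) * tailWeight m κ η b u ≠ ∞ := fun htop => by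
    rw [htop, ENNReal.mul_top (slope_const_ne_zero m c)] at hfin
    exact hfin rfl
  set α := tailWeight m κ 0 b 0 with hα
  set β := tailWeight m κ η b 0 with hβ
  have hα0 : α ≠ 0 := tailWeight_pos.ne'
  have hαt : α ≠ ∞ := tailWeight_ne_top hm
  have hβt : β ≠ ∞ := tailWeight_ne_top hm
  have hβα : β < α := tailWeight_lt_of_pos hm hκ hη
  have hpt : ∀ u, ENNReal.ofReal (-q u) * (β * tailWeight m κ 0 b u) ≤
      ENNReal.ofReal (-q u) * (tailWeight m κ η b u * α) := fun u => by
    rcases le_total 0 u with hu | hu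
    · rw [ENNReal.ofReal_of_nonpos (neg_nonpos.2 (hq.nonneg hu)), zero_mul]; exact zero_le
    · exact mul_le_mul_right (le_tailWeight_shift hm hκ hη.le hb hu) _
  have hN : ∫⁻ u, ENNReal.ofReal (-q u) * (tailWeight m κ η b u * α) =
      α * ∫⁻ u, ENNReal.ofReal (-q u) * tailWeight m κ η b u := by
    rw [← lintegral_const_mul' _ _ hαt]; exact lintegral_congr fun u => by ring
  have hmeas : Measurable fun u => ENNReal.ofReal (-q u) * (tailWeight m κ η b u * α) :=
    hq.measurable.neg.ennreal_ofReal.mul ((measurable_tailWeight m κ η b).mul_const _)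
  -- For u < -η both cutoffs are vacuous and the two tail weights agree, while β < α.
  have hstrict : ∫⁻ u, ENNReal.ofReal (-q u) * (β * tailWeight m κ 0 b u) <
      ∫⁻ u, ENNReal.ofReal (-q u) * (tailWeight m κ η b u * α) := by
    refine lintegral_strict_mono_of_ae_le_of_ae_lt_on (s := Iio (-η)) hmeas.aemeasurable
      (ne_top_of_le_ne_top ?_ (lintegral_mono hpt)) (Eventually.of_forall hpt) (by simp)
      (Eventually.of_forall fun u hu => ?_)
    · rw [hN]; exact ENNReal.mul_ne_top hαt hfin'
    · have hu : u < -η := hu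
      have hq0 : ENNReal.ofReal (-q u) ≠ 0 := by
        simpa using hq.neg_of_neg u (by linarith)
      rw [tailWeight_eq_of_lt_neg hκ.le hη.le hu, mul_comm _ α,
        ENNReal.mul_lt_mul_iff_right hq0 ENNReal.ofReal_ne_top,
        ENNReal.mul_lt_mul_iff_left tailWeight_pos.ne' (tailWeight_ne_top hm)]
      exact hβα
  rw [hN] at hstrict
  refine (ENNReal.mul_lt_mul_iff_right hα0 hαt).1 (lt_of_le_of_lt ?_ hstrict)
  calc α * ∫⁻ u, ENNReal.ofReal (q u) * tailWeight m κ η b u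
      = ∫⁻ u, ENNReal.ofReal (q u) * (tailWeight m κ η b u * α) := by
        rw [← lintegral_const_mul' _ _ hαt]; exact lintegral_congr fun u => by ring
    _ ≤ ∫⁻ u, ENNReal.ofReal (q u) * (β * tailWeight m κ 0 b u) := lintegral_mono fun u => by
        rcases le_total 0 u with hu | hu
        · exact mul_le_mul_right (tailWeight_shift_le hm hκ hη.le hb hu) _
        · rw [ENNReal.ofReal_of_nonpos (hq.nonpos hu), zero_mul]; exact zero_le
    _ = β * ∫⁻ u, ENNReal.ofReal (q u) * tailWeight m κ 0 b u := by
        rw [← lintegral_const_mul' _ _ hβt]; exact lintegral_congr fun u => by ring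
    _ ≤ β * ∫⁻ u, ENNReal.ofReal (-q u) * tailWeight m κ 0 b u := by gcongr
    _ = _ := by
        rw [← lintegral_const_mul' _ _ hβt]; exact lintegral_congr fun u => by ring

end

/-! ### The optimal coefficient as a function of the wedge -/

section

variable {ρ q f f₀ : ℝ → ℝ} {m c c' t η κ κ' b b' u l : ℝ} {A B : Set (ℝ × ℝ)}

lemma overPart_le_of_forall {S : ℕ → Set (ℝ × ℝ)} (hS : Monotone S)
    (hA : A ≤ᵐ[kernelMeasure m] ⋃ k, S k) {X : ℝ≥0∞} (h : ∀ k, overPart q m (S k) c ≤ X) :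
    overPart q m A c ≤ X := by
  have h1 : overPart q m A c ≤ overPart q m (⋃ k, S k) c :=
    lintegral_mono' (Measure.restrict_mono_ae hA) le_rfl
  refine h1.trans ?_
  unfold overPart
  rw [setLIntegral_iUnion_of_directed _ hS.directed_le]
  exact iSup_le h

lemma overPart_mono_set (h : A ⊆ B) : overPart q m A c ≤ overPart q m B c :=
  lintegral_mono' (Measure.restrict_mono h le_rfl) le_rfl

/-- Between two minimizers the derivative would be both strictly positive and strictly negative.
Uniqueness makes generalized Bayes estimators scale equivariant. -/
lemma IsOptimal.unique (hρ : IsConvexLoss ρ) (hq : IsSubderivative ρ q)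
    (h : IsOptimal ρ m (wedge t 0) c) (h' : IsOptimal ρ m (wedge t 0) c') : c = c' := by
  have key : ∀ {c c'}, IsOptimal ρ m (wedge t 0) c → IsOptimal ρ m (wedge t 0) c' → c' ≤ c := by
    intro c c' h h'
    by_contra! hlt
    obtain ⟨d, hd1, hd2⟩ := exists_between hlt
    have ht := h.neg_le hρ hq
    exact lt_asymm (h.underPart_lt_overPart hρ hq (containsUnder_wedge ht) hd1)
      (h'.overPart_lt_underPart hρ hq (containsUnder_wedge (ht.trans hd1.le)) hd2)
  exact le_antisymm (key h' h) (key h h')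

/-- At a fixed coefficient, enlarging t keeps b and lowers κ, which favours over-estimation. -/
lemma antitone_of_isOptimal (hρ : IsConvexLoss ρ) (hq : IsSubderivative ρ q)
    (h : ∀ t, IsOptimal ρ m (wedge t 0) (f t)) : Antitone f := by
  intro t s hts
  rcases hts.eq_or_lt with rfl | hts
  · exact le_rfl
  by_contra! hlt
  obtain ⟨d, hd1, hd2⟩ := exists_between hlt
  have ht := (h t).neg_le hρ hq
  have h1 := (h t).underPart_lt_overPart hρ hq (containsUnder_wedge ht) hd1
  have h2 := (h s).overPart_lt_underPart hρ hq (containsUnder_wedge (by linarith)) hd2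
  have hdt : 0 < d + t := by linarith
  refine h2.not_ge (overPart_tilt hq (hasSlope_wedge hdt) (hasSlope_wedge (by linarith)) le_rfl
    (by positivity) ?_ h1)
  gcongr

/-- The whole half plane has slope κ = 0, so it behaves like the wedge with t = ∞. -/
lemma IsOptimal.le_wedge (hρ : IsConvexLoss ρ) (hq : IsSubderivative ρ q)
    (h : IsOptimal ρ m univ c) (h' : IsOptimal ρ m (wedge t 0) c') : c ≤ c' := by
  by_contra! hlt
  obtain ⟨d, hd1, hd2⟩ := exists_between hlt
  have ht := h'.neg_le hρ hq
  have h1 := h'.underPart_lt_overPart hρ hq (containsUnder_wedge ht) hd1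
  have h2 := h.overPart_lt_underPart hρ hq (containsUnder_univ d) hd2
  have hdt : 0 < d + t := by linarith
  exact h2.not_ge (overPart_tilt hq (hasSlope_wedge hdt) (hasSlope_univ d) le_rfl
    (by positivity) (by positivity) h1)

/-- If `f` stayed above c + ε, under-estimation would prevail at c + ε/2 on every wedge, and by
monotone convergence on the half plane, where c + ε/2 lies above the minimizer. -/
lemma tendsto_of_isOptimal (hρ : IsConvexLoss ρ) (hq : IsSubderivative ρ q)
    (h : ∀ t, IsOptimal ρ m (wedge t 0) (f t)) (hc : IsOptimal ρ m univ c) :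
    Tendsto f atTop (𝓝 c) := by
  rw [Metric.tendsto_atTop]
  by_contra! hcon
  obtain ⟨ε, hε, hcon⟩ := hcon
  have hlow : ∀ t, c ≤ f t := fun t => hc.le_wedge hρ hq (h t)
  have hbig : ∀ t, c + ε ≤ f t := by
    intro t
    obtain ⟨s, hs, hd⟩ := hcon t
    rw [Real.dist_eq, abs_of_nonneg (by linarith [hlow s])] at hd
    linarith [antitone_of_isOptimal hρ hq h hs]
  have hlt := hc.underPart_lt_overPart hρ hq (containsUnder_univ c)
    (show c < c + ε / 2 by linarith)
  -- The wedges increase with k only where v > 0, hence the intersection.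
  refine hlt.not_ge (overPart_le_of_forall (S := fun k : ℕ => wedge k 0 ∩ sampleSpace) ?_ ?_
    fun k => ?_)
  · refine monotone_nat_of_le_succ fun k p hp => ⟨?_, hp.2⟩
    have h1 : p.1 + 0 ≤ k * p.2 := hp.1
    have h2 : 0 < p.2 := hp.2
    simp only [wedge, mem_ofPred_eq]
    push_cast
    linarith
  · filter_upwards [ae_kernelMeasure_snd_pos m] with p hp _
    obtain ⟨k, hk⟩ := exists_nat_ge (p.1 / p.2)
    rw [div_le_iff₀ hp] at hk
    exact mem_iUnion.2 ⟨k, by simpa [wedge] using hk, hp⟩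
  · refine (overPart_mono_set inter_subset_left).trans
      (((h k).overPart_le_underPart hρ hq (by linarith [hbig k])).trans ?_)
    exact lintegral_mono' (Measure.restrict_mono (subset_univ _) le_rfl) le_rfl

lemma IsOptimal.sq_add_lt_one (hρ : IsConvexLoss ρ) (hq : IsSubderivative ρ q) (hm : 0 ≤ m)
    (hpen : ∀ᵐ u : ℝ, 0 < u → -q (-u) ≤ q u) (h : IsOptimal ρ m (wedge t 0) c') (hc : 0 < c)
    (hlt : c < c') : c ^ 2 + 2 * c * t < 1 := by
  by_contra! hge
  have hct : 0 < c + t := by nlinarith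
  exact (h.overPart_lt_underPart hρ hq (containsUnder_wedge (by linarith)) hlt).not_ge
    (underPart_le_overPart_of_penalizes hq hm hpen hc hge)

lemma monotone_div_sqrt : Monotone fun c : ℝ => c / √(1 + c ^ 2) := by
  intro x y hxy
  simp only [← Real.sin_arctan]
  exact Real.strictMonoOn_sin.monotoneOn ⟨(Real.neg_pi_div_two_lt_arctan x).le,
    (Real.arctan_lt_pi_div_two x).le⟩ ⟨(Real.neg_pi_div_two_lt_arctan y).le,
    (Real.arctan_lt_pi_div_two y).le⟩ (Real.arctan_strictMono.monotone hxy)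

/-- If f(t - h) exceeded f(t) + Kh, some c just above f(t) would have c + Kh below f(t - h). Moving
from (t, c) to (t - h, c + Kh) raises b and lowers κ, so over-estimation would still prevail at a
coefficient below the minimizer. -/
lemma isOptimal_sub_le (hρ : IsConvexLoss ρ) (hq : IsSubderivative ρ q) (hm : 0 ≤ m)
    (hpen : ∀ᵐ u : ℝ, 0 < u → -q (-u) ≤ q u) {h C x y : ℝ}
    (hx : IsOptimal ρ m (wedge t 0) x) (hy : IsOptimal ρ m (wedge (t - h) 0) y)
    (hxC : |x| ≤ C) (hyC : |y| ≤ C) (hh : 0 < h) (hhC : C * h ≤ 1 / 4) :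
    y ≤ x + 4 * (1 + C ^ 2) * h := by
  set K := 4 * (1 + C ^ 2) with hK
  by_contra! hlt
  obtain ⟨c, hc1, hc2⟩ := exists_between (show x < y - K * h by linarith)
  have hKh : 0 < K * h := by positivity
  set c' := c + K * h with hc'
  have ht := hx.neg_le hρ hq
  have hct : 0 < c + t := by linarith
  have hc'y : c' < y := by linarith
  have hK4 : 4 ≤ K := by nlinarith
  have hct' : 0 < c' + (t - h) := by nlinarith
  rw [abs_le] at hxC hyC
  -- For c' > 0, `IsOptimal.sq_add_lt_one` gives 2c'(t - h) < 1, and c'h ≤ Ch ≤ 1/4.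
  have hprod : c' * t ≤ 3 / 4 := by
    rcases le_or_gt c' 0 with h0 | h0
    · nlinarith
    · have := hy.sq_add_lt_one hρ hq hm hpen h0 hc'y
      nlinarith
  have hcc : c * c' ≤ C ^ 2 := by
    have h1 : |c| ≤ C := abs_le.2 ⟨by linarith, by linarith⟩
    have h2 : |c'| ≤ C := abs_le.2 ⟨by linarith, by linarith⟩
    calc c * c' ≤ |c * c'| := le_abs_self _
      _ = |c| * |c'| := abs_mul _ _
      _ ≤ C * C := mul_le_mul h1 h2 (abs_nonneg _) ((abs_nonneg _).trans h1)
      _ = C ^ 2 := by ring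
  have hr0 : 0 < √(1 + c ^ 2) := by positivity
  have hr0' : 0 < √(1 + c' ^ 2) := by positivity
  have hκ : √(1 + c' ^ 2) / (c' + (t - h)) ≤ √(1 + c ^ 2) / (c + t) := by
    rw [div_le_div_iff₀ hct' hct]
    have hr2' : √(1 + c' ^ 2) ^ 2 = 1 + c' ^ 2 := Real.sq_sqrt (by positivity)
    have hrr : 1 + c * c' ≤ √(1 + c ^ 2) * √(1 + c' ^ 2) := by
      rw [← Real.sqrt_mul (by positivity)]
      refine Real.le_sqrt_of_sq_le ?_
      nlinarith [sq_nonneg (c - c')]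
    set r := √(1 + c ^ 2)
    set r' := √(1 + c' ^ 2)
    refine le_of_mul_le_mul_left ?_ hr0'
    have e1 : r' ^ 2 - r * r' ≤ c' * (K * h) := by
      have : c' * (K * h) = c' ^ 2 - c * c' := by rw [hc']; ring
      rw [this]; linarith
    have e2 : (r' ^ 2 - r * r') * (c + t) ≤ c' * (K * h) * (c + t) := by gcongr
    -- With c't ≤ 3/4 this reduces to 1 + cc' ≤ K/4 = 1 + C², which dictates the choice of K.
    have e3 : c' * K * (c + t) ≤ (K - 1) * (1 + c * c') := by nlinarith
    have e4 : (K - 1) * (1 + c * c') ≤ (K - 1) * (r * r') := by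
      gcongr; linarith
    have e5 : c' * (K * h) * (c + t) ≤ (K - 1) * (r * r') * h := by
      calc _ = c' * K * (c + t) * h := by ring
        _ ≤ _ := mul_le_mul_of_nonneg_right (e3.trans e4) hh.le
    have e6 : c' + (t - h) = c + t + (K - 1) * h := by rw [hc']; ring
    rw [e6]
    nlinarith
  have h1 := hx.underPart_lt_overPart hρ hq (containsUnder_wedge ht) hc1
  have h2 := hy.overPart_lt_underPart hρ hq (containsUnder_wedge (by linarith)) hc'y
  exact h2.not_ge (overPart_tilt hq (hasSlope_wedge hct) (hasSlope_wedge hct')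
    (monotone_div_sqrt (by linarith)) (by positivity) hκ h1)

lemma absolutelyContinuousOnInterval_of_isOptimal (hρ : IsConvexLoss ρ)
    (hq : IsSubderivative ρ q) (hm : 0 ≤ m) (hpen : ∀ᵐ u : ℝ, 0 < u → -q (-u) ≤ q u)
    (h : ∀ t, IsOptimal ρ m (wedge t 0) (f t)) (a b : ℝ) :
    AbsolutelyContinuousOnInterval f a b := by
  have hf := antitone_of_isOptimal hρ hq h
  set C := max |f a| |f b| with hC
  have hC0 : 0 ≤ C := (abs_nonneg _).trans (le_max_left _ _)
  have hbound : ∀ t ∈ uIcc a b, |f t| ≤ C := by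
    intro t ht
    rcases le_total a b with hab | hab
    · rw [uIcc_of_le hab] at ht
      rw [hC, max_comm]
      exact abs_le_max_abs_abs (hf ht.2) (hf ht.1)
    · rw [uIcc_of_ge hab] at ht
      exact abs_le_max_abs_abs (hf ht.2) (hf ht.1)
  have hlip : ∀ s ∈ uIcc a b, ∀ t ∈ uIcc a b, s ≤ t →
      f s - f t ≤ (4 * (1 + C ^ 2) + 8 * C ^ 2) * (t - s) := by
    intro s hs t ht hst
    rcases hst.eq_or_lt with rfl | hst
    · simp
    have hs' := hbound s hs
    have ht' := hbound t ht
    by_cases hh : C * (t - s) ≤ 1 / 4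
    · have := isOptimal_sub_le hρ hq hm hpen (h := t - s) (h t) (by simpa using h s) ht' hs'
        (by linarith) hh
      nlinarith [mul_nonneg (sq_nonneg C) (sub_nonneg.2 hst.le)]
    -- For steps with C(t - s) > 1/4 the trivial bound 2C is below 8C²(t - s).
    · have h1 := abs_le.1 hs'
      have h2 := abs_le.1 ht'
      nlinarith [mul_nonneg (sq_nonneg C) (sub_nonneg.2 hst.le)]
  have hK : (0 : ℝ) ≤ 4 * (1 + C ^ 2) + 8 * C ^ 2 := by positivity
  refine LipschitzOnWith.absolutelyContinuousOnInterval
    (K := ⟨4 * (1 + C ^ 2) + 8 * C ^ 2, hK⟩) ?_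
  refine LipschitzOnWith.of_dist_le_mul fun s hs t ht => ?_
  rw [Real.dist_eq, Real.dist_eq]
  rcases le_total s t with hst | hst
  · rw [abs_of_nonneg (sub_nonneg.2 (hf hst)), abs_sub_comm, abs_of_nonneg (sub_nonneg.2 hst)]
    exact hlip s hs t ht hst
  · rw [abs_sub_comm, abs_of_nonneg (sub_nonneg.2 (hf hst)), abs_of_nonneg (sub_nonneg.2 hst)]
    exact hlip t ht s hs hst

lemma IsOptimal.power_le (hρ : IsConvexLoss ρ) (hq : IsSubderivative ρ q) (hm : 0 ≤ m)
    (hl : 0 ≤ l) (h : IsOptimal ρ m (wedge t 0) c) (hc : 0 ≤ c)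
    (h' : IsOptimal ρ (m + l) (wedge t 0) c') : c' ≤ c := by
  by_contra! hlt
  obtain ⟨d, hd1, hd2⟩ := exists_between hlt
  have ht := h.neg_le hρ hq
  have h1 := h.underPart_lt_overPart hρ hq (containsUnder_wedge ht) hd1
  have h2 := h'.overPart_lt_underPart hρ hq (containsUnder_wedge (by linarith)) hd2
  have hdt : 0 < d + t := by linarith
  exact h2.not_ge (underPart_le_overPart_power hq (hasSlope_wedge hdt) hm hl (by positivity)
    (by linarith) h1.le)

/-- The bound f(t) ≥ -t makes `f` unbounded as t → -∞. -/
lemma nonconstant_of_isOptimal (hρ : IsConvexLoss ρ) (hq : IsSubderivative ρ q)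
    (h : ∀ t, IsOptimal ρ m (wedge t 0) (f t)) (c : ℝ) : ∃ t, c < f t := by
  refine ⟨-(c + 1), ?_⟩
  have := (h (-(c + 1))).neg_le hρ hq
  linarith

end

/-! ### Integral expression of the risk difference -/

section

variable {ρ q f g : ℝ → ℝ} {m c c₀ t η v x h u γ : ℝ} {A B : Set (ℝ × ℝ)}

lemma lintegral_Ioi_ite (h : ℝ) (F : ℝ → ℝ≥0∞) :
    ∫⁻ γ in Ioi 0, (if γ < h then F γ else 0) = ∫⁻ γ in Ioo 0 h, F γ := by
  rw [← lintegral_indicator measurableSet_Ioi, ← lintegral_indicator measurableSet_Ioo]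
  refine lintegral_congr fun γ => ?_
  by_cases h0 : 0 < γ <;> by_cases h1 : γ < h <;> simp [h0, h1]

lemma IsSubderivative.lintegral_identity (hρ : IsConvexLoss ρ) (hq : IsSubderivative ρ q)
    (hv : 0 < v) (hh : 0 ≤ h) (x : ℝ) :
    ENNReal.ofReal (ρ (x + h * v)) + ∫⁻ γ in Ioo 0 h, ENNReal.ofReal (-q (x + γ * v) * v) =
      ENNReal.ofReal (ρ x) + ∫⁻ γ in Ioo 0 h, ENNReal.ofReal (q (x + γ * v) * v) := by
  have hmono : Monotone fun γ => q (x + γ * v) * v := fun a b hab => by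
    have : q (x + a * v) ≤ q (x + b * v) := hq.monotone (by gcongr)
    dsimp only
    gcongr
  have hint : IntegrableOn (fun γ => q (x + γ * v) * v) (Ioo 0 h) :=
    ((hmono.monotoneOn _).integrableOn_isCompact isCompact_Icc).mono_set Ioo_subset_Icc_self
  have h1 : ρ (x + h * v) - ρ x = ∫ γ in Ioo 0 h, q (x + γ * v) * v := by
    rw [← integral_Ioc_eq_integral_Ioo, ← intervalIntegral.integral_of_le hh,
      ← hq.integral_eq, intervalIntegral.integral_mul_const, mul_comm]
    have := intervalIntegral.smul_integral_comp_add_mul (a := 0) (b := h) q v x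
    simp only [smul_eq_mul, mul_zero, add_zero] at this
    rw [← this]
    simp only [mul_comm v]
  rw [integral_eq_lintegral_pos_part_sub_lintegral_neg_part hint] at h1
  simp only [← neg_mul] at h1
  have hP : ∫⁻ γ in Ioo 0 h, ENNReal.ofReal (q (x + γ * v) * v) ≠ ∞ := hint.lintegral_lt_top.ne
  have hN : ∫⁻ γ in Ioo 0 h, ENNReal.ofReal (-q (x + γ * v) * v) ≠ ∞ := by
    have := hint.neg.lintegral_lt_top.ne
    simpa only [Pi.neg_apply, ← neg_mul] using this
  rw [← ENNReal.ofReal_toReal hP, ← ENNReal.ofReal_toReal hN,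
    ← ENNReal.ofReal_add (hρ.nonneg _) ENNReal.toReal_nonneg,
    ← ENNReal.ofReal_add (hρ.nonneg _) ENNReal.toReal_nonneg]
  congr 1
  linarith

/-- The loss decreases only until its argument reaches 0, so its total decrease is at most ρ(x).
This finiteness later allows the under part to be cancelled. -/
lemma IsSubderivative.lintegral_under_le (hρ : IsConvexLoss ρ) (hq : IsSubderivative ρ q)
    (hv : 0 < v) (h x : ℝ) :
    ∫⁻ γ in Ioo 0 h, ENNReal.ofReal (-q (x + γ * v) * v) ≤ ENNReal.ofReal (ρ x) := by
  rcases le_or_gt 0 x with hx | hx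
  · refine le_of_eq_of_le ?_ (zero_le (a := ENNReal.ofReal (ρ x)))
    rw [setLIntegral_congr_fun (g := fun _ => 0) measurableSet_Ioo, lintegral_zero]
    intro γ hγ
    have : 0 ≤ q (x + γ * v) := hq.nonneg (by nlinarith [hγ.1])
    exact ENNReal.ofReal_of_nonpos (by nlinarith)
  · set k := -x / v with hk
    have hk0 : 0 < k := div_pos (by linarith) hv
    have hkx : k * v = -x := div_mul_cancel₀ _ hv.ne'
    have h1 : ∫⁻ γ in Ioo 0 h, ENNReal.ofReal (-q (x + γ * v) * v) ≤
        ∫⁻ γ in Ioo 0 k, ENNReal.ofReal (-q (x + γ * v) * v) := by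
      rw [← lintegral_indicator measurableSet_Ioo, ← lintegral_indicator measurableSet_Ioo]
      refine lintegral_mono fun γ => ?_
      by_cases hγ : γ ∈ Ioo 0 h
      · rw [indicator_of_mem hγ]
        by_cases hγk : γ < k
        · rw [indicator_of_mem (show γ ∈ Ioo 0 k from ⟨hγ.1, hγk⟩)]
        · have : 0 ≤ q (x + γ * v) := hq.nonneg (by nlinarith [hγ.1])
          rw [ENNReal.ofReal_of_nonpos (by nlinarith)]
          exact zero_le
      · rw [indicator_of_notMem hγ]; exact zero_le
    have h2 := hq.lintegral_identity hρ hv hk0.le x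
    have h3 : ∫⁻ γ in Ioo 0 k, ENNReal.ofReal (q (x + γ * v) * v) = 0 := by
      rw [setLIntegral_congr_fun (g := fun _ => 0) measurableSet_Ioo, lintegral_zero]
      intro γ hγ
      have : q (x + γ * v) ≤ 0 := hq.nonpos (by nlinarith [hγ.2])
      exact ENNReal.ofReal_of_nonpos (by nlinarith)
    rw [h3, add_zero] at h2
    exact h1.trans (le_trans le_add_self h2.le)

/-- The region on which the expansion `g` exceeds the level `γ`, when `μ / σ = η`. -/
def superlevel (g : ℝ → ℝ) (η γ : ℝ) : Set (ℝ × ℝ) := {p | γ < g ((η + p.1) / p.2)}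

/-- The loss of `z + (c₀ + g ((η + z) / v)) v` under the kernel measure. -/
def expandedLoss (ρ : ℝ → ℝ) (m c₀ : ℝ) (g : ℝ → ℝ) (η : ℝ) : ℝ≥0∞ :=
  ∫⁻ p, ENNReal.ofReal (ρ (p.1 + (c₀ + g ((η + p.1) / p.2)) * p.2)) ∂kernelMeasure m

lemma measurableSet_superlevel (hg : Measurable g) (η γ : ℝ) :
    MeasurableSet (superlevel g η γ) :=
  measurableSet_lt measurable_const (hg.comp (by fun_prop))

lemma measurable_superlevel_under (hq : IsSubderivative ρ q) (hg : Measurable g) (c₀ η : ℝ) :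
    Measurable fun r : ℝ × ℝ × ℝ => if r.1 < g ((η + r.2.1) / r.2.2) then
      ENNReal.ofReal (-q (r.2.1 + (c₀ + r.1) * r.2.2) * r.2.2) else 0 :=
  Measurable.ite (measurableSet_lt (by fun_prop) (hg.comp (by fun_prop)))
    (((hq.measurable.comp (by fun_prop)).neg.mul (by fun_prop)).ennreal_ofReal) measurable_const

lemma measurable_superlevel_over (hq : IsSubderivative ρ q) (hg : Measurable g) (c₀ η : ℝ) :
    Measurable fun r : ℝ × ℝ × ℝ => if r.1 < g ((η + r.2.1) / r.2.2) then
      ENNReal.ofReal (q (r.2.1 + (c₀ + r.1) * r.2.2) * r.2.2) else 0 :=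
  Measurable.ite (measurableSet_lt (by fun_prop) (hg.comp (by fun_prop)))
    (((hq.measurable.comp (by fun_prop)).mul (by fun_prop)).ennreal_ofReal) measurable_const

lemma setLIntegral_superlevel (hg : Measurable g) (m η γ : ℝ) (F : ℝ × ℝ → ℝ≥0∞) :
    ∫⁻ p in superlevel g η γ, F p ∂kernelMeasure m =
      ∫⁻ p, if γ < g ((η + p.1) / p.2) then F p else 0 ∂kernelMeasure m := by
  rw [← lintegral_indicator (measurableSet_superlevel hg η γ)]
  refine lintegral_congr fun p => ?_
  simp only [indicator_apply, superlevel, mem_ofPred_eq]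

lemma lintegral_underPart_superlevel (hq : IsSubderivative ρ q) (hg : Measurable g)
    (m c₀ η : ℝ) : ∫⁻ γ in Ioi 0, underPart q m (superlevel g η γ) (c₀ + γ) =
      ∫⁻ p : ℝ × ℝ, (∫⁻ γ in Ioo 0 (g ((η + p.1) / p.2)),
        ENNReal.ofReal (-q (p.1 + c₀ * p.2 + γ * p.2) * p.2)) ∂kernelMeasure m := by
  simp only [underPart, setLIntegral_superlevel hg]
  rw [lintegral_lintegral_swap (measurable_superlevel_under hq hg c₀ η).aemeasurable]
  refine lintegral_congr fun p => ?_
  rw [lintegral_Ioi_ite]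
  simp only [add_mul, add_assoc]

lemma lintegral_overPart_superlevel (hq : IsSubderivative ρ q) (hg : Measurable g)
    (m c₀ η : ℝ) : ∫⁻ γ in Ioi 0, overPart q m (superlevel g η γ) (c₀ + γ) =
      ∫⁻ p : ℝ × ℝ, (∫⁻ γ in Ioo 0 (g ((η + p.1) / p.2)),
        ENNReal.ofReal (q (p.1 + c₀ * p.2 + γ * p.2) * p.2)) ∂kernelMeasure m := by
  simp only [overPart, setLIntegral_superlevel hg]
  rw [lintegral_lintegral_swap (measurable_superlevel_over hq hg c₀ η).aemeasurable]
  refine lintegral_congr fun p => ?_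
  rw [lintegral_Ioi_ite]
  simp only [add_mul, add_assoc]

/-- At each point the loss increment is the integral of its derivative over 0 < γ < g; Tonelli then
exchanges γ with (z, v). -/
lemma expandedLoss_add_under (hρ : IsConvexLoss ρ) (hq : IsSubderivative ρ q)
    (hg : Measurable g) (hg0 : ∀ y, 0 ≤ g y) (m c₀ η : ℝ) :
    expandedLoss ρ m c₀ g η + ∫⁻ γ in Ioi 0, underPart q m (superlevel g η γ) (c₀ + γ) =
      regionLoss ρ m univ c₀ + ∫⁻ γ in Ioi 0, overPart q m (superlevel g η γ) (c₀ + γ) := by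
  rw [lintegral_underPart_superlevel hq hg, lintegral_overPart_superlevel hq hg, regionLoss,
    Measure.restrict_univ, expandedLoss,
    ← lintegral_add_left (measurable_loss hρ c₀), ← lintegral_add_left]
  · refine lintegral_congr_ae ?_
    filter_upwards [ae_kernelMeasure_snd_pos m] with p hp
    have := hq.lintegral_identity hρ hp (hg0 ((η + p.1) / p.2)) (p.1 + c₀ * p.2)
    rwa [add_assoc, ← add_mul] at this
  · exact (hρ.measurable.comp (measurable_fst.add
      ((measurable_const.add (hg.comp (by fun_prop))).mul measurable_snd))).ennreal_ofReal

lemma lintegral_underPart_superlevel_le (hρ : IsConvexLoss ρ) (hq : IsSubderivative ρ q)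
    (hg : Measurable g) (m c₀ η : ℝ) :
    ∫⁻ γ in Ioi 0, underPart q m (superlevel g η γ) (c₀ + γ) ≤ regionLoss ρ m univ c₀ := by
  rw [lintegral_underPart_superlevel hq hg, regionLoss, Measure.restrict_univ]
  refine lintegral_mono_ae ?_
  filter_upwards [ae_kernelMeasure_snd_pos m] with p hp
  exact hq.lintegral_under_le hρ hp _ _

lemma ae_ne_line (m t η : ℝ) : ∀ᵐ p ∂kernelMeasure m, p.1 + η ≠ t * p.2 := by
  have hac := (kernelMeasure_absolutelyContinuous m).ae_le
  refine Eventually.filter_mono hac ?_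
  have hm : MeasurableSet {p : ℝ × ℝ | p.1 + η = t * p.2} :=
    measurableSet_eq_fun (by fun_prop) (by fun_prop)
  rw [ae_iff]
  simp only [ne_eq, not_not]
  rw [Measure.volume_eq_prod, Measure.prod_apply_symm hm]
  refine (lintegral_congr fun y => ?_).trans lintegral_zero
  refine measure_mono_null (fun x hx => ?_) (measure_singleton (t * y - η))
  have : x + η = t * y := hx
  simp only [mem_singleton_iff]
  linarith

/-- The level at which a nonincreasing function crosses `γ`. -/
lemma exists_superlevel_eq (hg : Antitone g) (hlim : Tendsto g atTop (𝓝 0)) (hγ : 0 < γ)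
    (hne : ∃ y, γ < g y) :
    ∃ τ, (∀ y < τ, γ < g y) ∧ ∀ m η, superlevel g η γ =ᵐ[kernelMeasure m] wedge τ η := by
  have hbdd : BddAbove {y | γ < g y} := by
    obtain ⟨T, hT⟩ := (hlim.eventually (gt_mem_nhds hγ)).exists
    refine ⟨T, fun y hy => ?_⟩
    by_contra! hlt
    have : γ < g y := hy
    linarith [hg hlt.le]
  have hne' : {y | γ < g y}.Nonempty := hne
  refine ⟨sSup {y | γ < g y}, ?_, fun m η => ?_⟩
  · intro y hy
    obtain ⟨x, hx, hyx⟩ := exists_lt_of_lt_csSup hne' hy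
    exact lt_of_lt_of_le hx (hg hyx.le)
  · filter_upwards [ae_kernelMeasure_snd_pos m, ae_ne_line m (sSup {y | γ < g y}) η] with p hp hpn
    refine propext ⟨fun h => ?_, fun h => ?_⟩
    · have h : γ < g ((η + p.1) / p.2) := h
      have := le_csSup hbdd h
      rw [div_le_iff₀ hp] at this
      change p.1 + η ≤ _
      linarith
    · have h : p.1 + η ≤ sSup {y | γ < g y} * p.2 := h
      have hlt : (η + p.1) / p.2 < sSup {y | γ < g y} := by
        rw [div_lt_iff₀ hp]
        have := lt_of_le_of_ne h hpn
        linarith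
      obtain ⟨x, hx, hyx⟩ := exists_lt_of_lt_csSup hne' hlt
      exact lt_of_lt_of_le hx (hg hyx.le)

lemma overPart_congr_set (h : A =ᵐ[kernelMeasure m] B) : overPart q m A c = overPart q m B c := by
  unfold overPart; rw [Measure.restrict_congr_set h]

lemma underPart_congr_set (h : A =ᵐ[kernelMeasure m] B) :
    underPart q m A c = underPart q m B c := by
  unfold underPart; rw [Measure.restrict_congr_set h]

/-- Wedges with parameters y_k increasing to t exhaust the wedge of t up to its null boundary line;
no comparison of `c` with f(t) itself is needed. -/
lemma overPart_le_underPart_of_forall_lt (hρ : IsConvexLoss ρ) (hq : IsSubderivative ρ q)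
    (hf : ∀ t, IsOptimal ρ m (wedge t 0) (f t)) (hc : ∀ y < t, c < f y) :
    overPart q m (wedge t 0) c ≤ underPart q m (wedge t 0) c := by
  set y : ℕ → ℝ := fun k => t - 1 / ((k : ℝ) + 1) with hy
  have hyt : ∀ k, y k < t := fun k => sub_lt_self _ (by positivity)
  have hymono : Monotone y := fun i j hij => by
    simp only [hy]
    gcongr
  refine overPart_le_of_forall (S := fun k : ℕ => wedge (y k) 0 ∩ sampleSpace) ?_ ?_
    fun k => ?_
  · refine fun i j hij p hp => ⟨?_, hp.2⟩
    have h1 : p.1 + 0 ≤ y i * p.2 := hp.1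
    have h2 : 0 < p.2 := hp.2
    exact h1.trans (by have := hymono hij; gcongr)
  · filter_upwards [ae_kernelMeasure_snd_pos m, ae_ne_line m t 0] with p hp hpn hpt
    have hpt : p.1 + 0 ≤ t * p.2 := hpt
    have hlt : p.1 / p.2 < t := by
      rw [div_lt_iff₀ hp]
      have := lt_of_le_of_ne hpt hpn
      linarith
    obtain ⟨k, hk⟩ := exists_nat_one_div_lt (sub_pos.2 hlt)
    refine mem_iUnion.2 ⟨k, ?_, hp⟩
    have : p.1 / p.2 ≤ y k := by simp only [hy]; linarith
    rw [div_le_iff₀ hp] at this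
    simpa [wedge] using this
  · refine (overPart_mono_set inter_subset_left).trans
      (((hf (y k)).overPart_le_underPart hρ hq (hc _ (hyt k))).trans ?_)
    refine lintegral_mono' (Measure.restrict_mono_ae ?_) le_rfl
    filter_upwards [ae_kernelMeasure_snd_pos m] with p hp hpk
    have hpk : p.1 + 0 ≤ y k * p.2 := hpk
    exact hpk.trans (by have := (hyt k).le; gcongr)

/-- For c > 0 the reflection bound gives 2cy < 1 for all y < t, hence ct ≤ 1/2; for c ≤ 0 the
product is nonpositive. -/
lemma mul_le_one_of_forall_lt (hρ : IsConvexLoss ρ) (hq : IsSubderivative ρ q) (hm : 0 ≤ m)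
    (hpen : ∀ᵐ u : ℝ, 0 < u → -q (-u) ≤ q u)
    (hf : ∀ t, IsOptimal ρ m (wedge t 0) (f t)) (hc : ∀ y < t, c < f y) (hct : 0 < c + t) :
    c * t ≤ 1 := by
  rcases le_or_gt c 0 with h0 | h0
  · nlinarith
  · have : ∀ y < t, y ≤ 1 / (2 * c) := fun y hy => by
      have := (hf y).sq_add_lt_one hρ hq hm hpen h0 (hc y hy)
      rw [le_div_iff₀ (by positivity)]
      nlinarith
    have h1 : t ≤ 1 / (2 * c) := le_of_forall_lt_imp_le_of_dense this
    rw [le_div_iff₀ (by positivity)] at h1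
    nlinarith

lemma overPart_superlevel_le (hρ : IsConvexLoss ρ) (hq : IsSubderivative ρ q) (hm : 0 ≤ m)
    (hpen : ∀ᵐ u : ℝ, 0 < u → -q (-u) ≤ q u) (hf : ∀ t, IsOptimal ρ m (wedge t 0) (f t))
    (hg : Antitone g) (hlim : Tendsto g atTop (𝓝 0)) (hle : ∀ y, c₀ + g y ≤ f y)
    (hγ : 0 < γ) (hη : 0 ≤ η) :
    overPart q m (superlevel g η γ) (c₀ + γ) ≤ underPart q m (superlevel g η γ) (c₀ + γ) := by
  by_cases hne : ∃ y, γ < g y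
  · obtain ⟨τ, hτ, hset⟩ := exists_superlevel_eq hg hlim hγ hne
    rw [overPart_congr_set (hset m η), underPart_congr_set (hset m η)]
    have hc : ∀ y < τ, c₀ + γ < f y := fun y hy => by linarith [hτ y hy, hle y]
    exact overPart_le_underPart_shift hq hm
      (fun h => mul_le_one_of_forall_lt hρ hq hm hpen hf hc h) hη
      (overPart_le_underPart_of_forall_lt hρ hq hf hc)
  · have : superlevel g η γ = ∅ := by
      ext p
      simp only [superlevel, mem_ofPred_eq, mem_empty_iff_false, iff_false]
      exact fun h => hne ⟨_, h⟩
    rw [this]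
    simp [overPart]

lemma overPart_superlevel_lt (hρ : IsConvexLoss ρ) (hq : IsSubderivative ρ q) (hm : 0 ≤ m)
    (hpen : ∀ᵐ u : ℝ, 0 < u → -q (-u) ≤ q u) (hf : ∀ t, IsOptimal ρ m (wedge t 0) (f t))
    (hg : Antitone g) (hlim : Tendsto g atTop (𝓝 0)) (hle : ∀ y, c₀ + g y ≤ f y)
    (hγ : 0 < γ) (hη : 0 < η) (hne : ∃ y, γ < g y)
    (hfin : underPart q m (superlevel g η γ) (c₀ + γ) ≠ ∞) :
    overPart q m (superlevel g η γ) (c₀ + γ) < underPart q m (superlevel g η γ) (c₀ + γ) := by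
  obtain ⟨τ, hτ, hset⟩ := exists_superlevel_eq hg hlim hγ hne
  rw [overPart_congr_set (hset m η), underPart_congr_set (hset m η)]
  rw [underPart_congr_set (hset m η)] at hfin
  have hc : ∀ y < τ, c₀ + γ < f y := fun y hy => by linarith [hτ y hy, hle y]
  exact overPart_lt_underPart_shift hq hm
    (fun h => mul_le_one_of_forall_lt hρ hq hm hpen hf hc h) hη
    (overPart_le_underPart_of_forall_lt hρ hq hf hc) hfin

lemma expandedLoss_le (hρ : IsConvexLoss ρ) (hq : IsSubderivative ρ q) (hm : 0 ≤ m)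
    (hpen : ∀ᵐ u : ℝ, 0 < u → -q (-u) ≤ q u) (hf : ∀ t, IsOptimal ρ m (wedge t 0) (f t))
    (hg : Antitone g) (hlim : Tendsto g atTop (𝓝 0)) (hle : ∀ y, c₀ + g y ≤ f y)
    (hfin : regionLoss ρ m univ c₀ < ∞) (hη : 0 ≤ η) :
    expandedLoss ρ m c₀ g η ≤ regionLoss ρ m univ c₀ := by
  have hid := expandedLoss_add_under hρ hq hg.measurable (fun y => hg.le_of_tendsto hlim y) m c₀ η
  have hN := (lintegral_underPart_superlevel_le hρ hq hg.measurable m c₀ η).trans_lt hfin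
  refine (ENNReal.add_le_add_iff_right hN.ne).1 (hid.trans_le ?_)
  exact add_le_add_right (setLIntegral_mono' measurableSet_Ioi fun γ hγ =>
    overPart_superlevel_le hρ hq hm hpen hf hg hlim hle hγ hη) _

lemma expandedLoss_lt (hρ : IsConvexLoss ρ) (hq : IsSubderivative ρ q) (hm : 0 ≤ m)
    (hpen : ∀ᵐ u : ℝ, 0 < u → -q (-u) ≤ q u) (hf : ∀ t, IsOptimal ρ m (wedge t 0) (f t))
    (hg : Antitone g) (hlim : Tendsto g atTop (𝓝 0)) (hle : ∀ y, c₀ + g y ≤ f y)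
    (hne : ∃ y, g y ≠ 0) (hfin : regionLoss ρ m univ c₀ < ∞) (hη : 0 < η) :
    expandedLoss ρ m c₀ g η < regionLoss ρ m univ c₀ := by
  have hg0 : ∀ y, 0 ≤ g y := fun y => hg.le_of_tendsto hlim y
  have hid := expandedLoss_add_under hρ hq hg.measurable hg0 m c₀ η
  have hN := (lintegral_underPart_superlevel_le hρ hq hg.measurable m c₀ η).trans_lt hfin
  obtain ⟨y, hy⟩ := hne
  have hy0 : 0 < g y := lt_of_le_of_ne (hg0 y) hy.symm
  have hmeas : Measurable fun γ => underPart q m (superlevel g η γ) (c₀ + γ) := by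
    simp only [underPart, setLIntegral_superlevel hg.measurable]
    exact (measurable_superlevel_under hq hg.measurable c₀ η).lintegral_prod_right'
  have hle' : ∀ᵐ γ ∂volume.restrict (Ioi 0), overPart q m (superlevel g η γ) (c₀ + γ) ≤
      underPart q m (superlevel g η γ) (c₀ + γ) := by
    filter_upwards [ae_restrict_mem measurableSet_Ioi] with γ hγ
    exact overPart_superlevel_le hρ hq hm hpen hf hg hlim hle hγ hη.le
  have hlt : ∫⁻ γ in Ioi 0, overPart q m (superlevel g η γ) (c₀ + γ) <
      ∫⁻ γ in Ioi 0, underPart q m (superlevel g η γ) (c₀ + γ) := by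
    refine lintegral_strict_mono_of_ae_le_of_ae_lt_on (s := Ioo 0 (g y)) hmeas.aemeasurable
      (ne_top_of_le_ne_top hN.ne (lintegral_mono_ae hle')) hle' ?_ ?_
    · rw [Measure.restrict_apply measurableSet_Ioo, inter_eq_left.2 Ioo_subset_Ioi_self]
      simp [hy0]
    -- Strictness at level γ needs a finite under part, which holds for almost every γ because the
    -- integral over γ is finite.
    · filter_upwards [ae_lt_top hmeas hN.ne] with γ hγ hmem
      exact overPart_superlevel_lt hρ hq hm hpen hf hg hlim hle hmem.1 hη ⟨y, hmem.2⟩ hγ.ne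
  refine (ENNReal.add_lt_add_iff_right hN.ne).1 (hid.trans_lt ?_)
  exact (ENNReal.add_lt_add_iff_left hfin.ne).2 hlt

end

/-! ### Reduction of the model and of the posterior to the kernel measure -/

section

variable {ρ q f g : ℝ → ℝ} {m c c₀ t η v x h u γ : ℝ} {A B : Set (ℝ × ℝ)} {n : ℕ} {μ σ s l d : ℝ}

/-- The normalizing constant of the joint density of a normal and a chi variable. -/
def modelConst (n : ℕ) : ℝ :=
  (√(2 * Real.pi))⁻¹ / (Real.Gamma ((n : ℝ) / 2) * 2 ^ ((n : ℝ) / 2 - 1))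

lemma modelConst_pos (hn : 1 ≤ n) : 0 < modelConst n := by
  have : (0 : ℝ) < n := by exact_mod_cast hn
  have := Real.Gamma_pos_of_pos (show (0 : ℝ) < (n : ℝ) / 2 by positivity)
  unfold modelConst
  positivity

lemma gaussian_mul_chi (hn : 1 ≤ n) (z v : ℝ) :
    gaussianPDFReal 0 1 z * chiPDF n v =
      modelConst n * (v ^ ((n : ℝ) - 1) * Real.exp (-(z ^ 2 + v ^ 2) / 2)) := by
  have hpow : v ^ ((n : ℝ) - 1) = v ^ (n - 1) := by
    rw [← Real.rpow_natCast]; push_cast [Nat.cast_sub hn]; rfl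
  have hexp : -(z ^ 2 + v ^ 2) / 2 = -z ^ 2 / 2 + -v ^ 2 / 2 := by ring
  rw [hpow, hexp, Real.exp_add, gaussianPDFReal, chiPDF, modelConst]
  simp only [NNReal.coe_one, mul_one, sub_zero]
  ring

lemma measurable_modelPDF (n : ℕ) (μ σ : ℝ) : Measurable (modelPDF n μ σ) := by
  unfold modelPDF chiPDF
  refine (measurable_const.mul ((measurable_gaussianPDFReal 0 1).comp (by fun_prop))).mul ?_
  fun_prop

lemma lintegral_comp_smul_prod (hσ : 0 < σ) (F : ℝ × ℝ → ℝ≥0∞) :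
    ∫⁻ p, F p = ENNReal.ofReal (σ ^ 2) * ∫⁻ p : ℝ × ℝ, F (σ • p) := by
  have h := lintegral_map_equiv (μ := volume) F
    (Homeomorph.smulOfNeZero σ hσ.ne' : ℝ × ℝ ≃ₜ ℝ × ℝ).toMeasurableEquiv
  have hm : Measure.map (Homeomorph.smulOfNeZero σ hσ.ne' : ℝ × ℝ ≃ₜ ℝ × ℝ).toMeasurableEquiv
      (volume : Measure (ℝ × ℝ)) = ENNReal.ofReal |(σ ^ Module.finrank ℝ (ℝ × ℝ))⁻¹| • volume :=
    Measure.map_addHaar_smul volume hσ.ne'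
  have hd : Module.finrank ℝ (ℝ × ℝ) = 2 := by simp
  rw [hm, lintegral_smul_measure, hd, abs_of_pos (by positivity)] at h
  change _ = _ * ∫⁻ p, F ((Homeomorph.smulOfNeZero σ hσ.ne' : ℝ × ℝ ≃ₜ ℝ × ℝ).toMeasurableEquiv p)
  rw [← h, smul_eq_mul, ← mul_assoc, ← ENNReal.ofReal_mul (by positivity),
    mul_inv_cancel₀ (by positivity), ENNReal.ofReal_one, one_mul]

lemma lintegral_model (hn : 1 ≤ n) (μ : ℝ) (hσ : 0 < σ) (F : ℝ × ℝ → ℝ≥0∞) :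
    ∫⁻ p, F p ∂model n μ σ = ENNReal.ofReal (modelConst n) *
      ∫⁻ p, F (μ + σ * p.1, σ * p.2) ∂kernelMeasure ((n : ℝ) - 1) := by
  unfold model
  rw [lintegral_withDensity_eq_lintegral_mul_non_measurable _
    (measurable_modelPDF n μ σ).ennreal_ofReal
    (Eventually.of_forall fun _ => ENNReal.ofReal_lt_top), lintegral_kernelMeasure,
    ← lintegral_indicator measurableSet_sampleSpace, ← lintegral_indicator measurableSet_sampleSpace,
    ← lintegral_add_left_eq_self _ ((μ, 0) : ℝ × ℝ), lintegral_comp_smul_prod hσ,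
    ← lintegral_const_mul' _ _ ENNReal.ofReal_ne_top,
    ← lintegral_const_mul' _ _ ENNReal.ofReal_ne_top]
  refine lintegral_congr fun p => ?_
  by_cases hp : 0 < p.2
  · have h1 : p ∈ sampleSpace := hp
    have h2 : ((μ, 0) + σ • p : ℝ × ℝ) ∈ sampleSpace := by
      change 0 < 0 + σ * p.2
      positivity
    have h3 : ((μ, 0) + σ • p : ℝ × ℝ) = (μ + σ * p.1, σ * p.2) := by
      ext <;> simp
    rw [indicator_of_mem h1, indicator_of_mem h2, h3]
    simp only [Pi.mul_apply]
    rw [← mul_assoc, ← mul_assoc, ← ENNReal.ofReal_mul (by positivity),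
      ← ENNReal.ofReal_mul (modelConst_pos hn).le, ← gaussian_mul_chi hn, modelPDF]
    congr 2
    simp only [add_sub_cancel_left]
    rw [mul_div_cancel_left₀ _ hσ.ne', mul_div_cancel_left₀ _ hσ.ne']
    field_simp
  · have h1 : p ∉ sampleSpace := hp
    have h2 : ((μ, 0) + σ • p : ℝ × ℝ) ∉ sampleSpace := by
      change ¬ 0 < 0 + σ * p.2
      nlinarith
    rw [indicator_of_notMem h1, indicator_of_notMem h2, mul_zero, mul_zero]

lemma risk_eq (hn : 1 ≤ n) (δ : ℝ × ℝ → ℝ) (μ : ℝ) (hσ : 0 < σ) :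
    risk n ρ δ μ σ = ENNReal.ofReal (modelConst n) *
      ∫⁻ p, ENNReal.ofReal (ρ ((δ (μ + σ * p.1, σ * p.2) - μ) / σ))
        ∂kernelMeasure ((n : ℝ) - 1) :=
  lintegral_model hn μ hσ _

lemma risk_equivariant (hn : 1 ≤ n) (c μ : ℝ) (hσ : 0 < σ) :
    risk n ρ (equivariant c) μ σ =
      ENNReal.ofReal (modelConst n) * regionLoss ρ ((n : ℝ) - 1) univ c := by
  rw [risk_eq hn _ _ hσ, regionLoss, Measure.restrict_univ]
  congr 2
  ext p
  congr 2
  simp only [equivariant]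
  field_simp
  ring

lemma risk_expand (hn : 1 ≤ n) (c₀ : ℝ) (g : ℝ → ℝ) (μ : ℝ) (hσ : 0 < σ) :
    risk n ρ (expand c₀ g) μ σ =
      ENNReal.ofReal (modelConst n) * expandedLoss ρ ((n : ℝ) - 1) c₀ g (μ / σ) := by
  rw [risk_eq hn _ _ hσ, expandedLoss]
  congr 1
  refine lintegral_congr_ae ?_
  filter_upwards [ae_kernelMeasure_snd_pos ((n : ℝ) - 1)] with p hp
  congr 2
  have : (μ + σ * p.1) / (σ * p.2) = (μ / σ + p.1) / p.2 := by field_simp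
  simp only [expand, equivariant, this]
  field_simp
  ring

lemma lintegral_Ioi_comp_div (hs : 0 < s) (F : ℝ → ℝ≥0∞) :
    ∫⁻ σ in Ioi 0, F σ = ∫⁻ v in Ioi 0, ENNReal.ofReal (s / v ^ 2) * F (s / v) := by
  have himg : (fun v => s / v) '' Ioi (0 : ℝ) = Ioi 0 := by
    ext y
    constructor
    · rintro ⟨v, hv, rfl⟩
      exact div_pos hs hv
    · intro hy
      have hy : 0 < y := hy
      exact ⟨s / y, div_pos hs hy, by field_simp⟩
  have hinj : InjOn (fun v => s / v) (Ioi (0 : ℝ)) := by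
    intro a ha b hb hab
    have ha : 0 < a := ha
    have hb : 0 < b := hb
    have hab : s / a = s / b := hab
    field_simp at hab
    exact hab.symm
  have hder : ∀ v ∈ Ioi (0 : ℝ), HasDerivWithinAt (fun v => s / v) (-(s / v ^ 2)) (Ioi 0) v := by
    intro v hv
    have hv : 0 < v := hv
    have := ((hasDerivAt_inv hv.ne').const_mul s).hasDerivWithinAt (s := Ioi 0)
    simpa [div_eq_mul_inv] using this
  have := lintegral_image_eq_lintegral_abs_deriv_mul measurableSet_Ioi hder hinj F
  rw [himg] at this
  rw [this]
  refine setLIntegral_congr_fun measurableSet_Ioi fun v hv => ?_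
  have hv : 0 < v := hv
  simp only [abs_neg]
  rw [abs_of_pos (by positivity)]

lemma lintegral_location (hσ : 0 < σ) (x : ℝ) (F : ℝ → ℝ≥0∞) :
    ∫⁻ μ, F μ = ENNReal.ofReal σ * ∫⁻ z, F (x - σ * z) := by
  have h := lintegral_comp_mul_left hσ.ne' fun y => F (x - y)
  rw [lintegral_sub_left_eq_self F x, abs_of_pos (inv_pos.2 hσ)] at h
  rw [h, ← mul_assoc, ← ENNReal.ofReal_mul hσ.le, mul_inv_cancel₀ hσ.ne', ENNReal.ofReal_one,
    one_mul]

lemma measurableSet_paramSpace : MeasurableSet paramSpace :=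
  (measurableSet_le measurable_const measurable_fst).inter
    (measurableSet_lt measurable_const measurable_snd)

/-- The substitution σ = s/v, μ = x - σz turns the parameter space into the wedge z ≤ (x/s)v and the
loss argument into z + ((d - x)/s)v. The prior and the Jacobian raise the power of v to n - 1 + l.
-/
lemma posteriorLoss_eq (hρ : IsConvexLoss ρ) (hn : 1 ≤ n) (l x : ℝ) (hs : 0 < s) (d : ℝ) :
    posteriorLoss n ρ l (x, s) d = ENNReal.ofReal (modelConst n * s ^ (-(l + 1))) *
      regionLoss ρ ((n : ℝ) - 1 + l) (wedge (x / s) 0) ((d - x) / s) := by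
  set G : ℝ × ℝ → ℝ≥0∞ := paramSpace.indicator fun θ => ENNReal.ofReal (ρ ((d - θ.1) / θ.2)) *
      ENNReal.ofReal (modelPDF n θ.1 θ.2 (x, s) * θ.2 ^ (-(l + 1))) with hG
  have hGm : Measurable G := by
    refine Measurable.indicator ?_ measurableSet_paramSpace
    refine (hρ.measurable.comp (by fun_prop)).ennreal_ofReal.mul
      (Measurable.ennreal_ofReal (Measurable.mul ?_ (by fun_prop)))
    unfold modelPDF chiPDF
    refine (Measurable.mul (by fun_prop)
      ((measurable_gaussianPDFReal 0 1).comp (by fun_prop))).mul ?_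
    fun_prop
  set W : ℝ × ℝ → ℝ≥0∞ := (sampleSpace ∩ wedge (x / s) 0).indicator fun p =>
    ENNReal.ofReal (p.2 ^ ((n : ℝ) - 1 + l) * Real.exp (-(p.1 ^ 2 + p.2 ^ 2) / 2)) *
      ENNReal.ofReal (ρ (p.1 + (d - x) / s * p.2)) with hW
  have hWm : Measurable W :=
    ((measurable_kernel _).mul (measurable_loss hρ _)).indicator
      (measurableSet_sampleSpace.inter (measurableSet_wedge _ _))
  have h1 : posteriorLoss n ρ l (x, s) d = ∫⁻ σ, ∫⁻ μ, G (μ, σ) := by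
    rw [posteriorLoss, ← lintegral_indicator measurableSet_paramSpace, Measure.volume_eq_prod,
      lintegral_prod_symm' _ hGm]
  have h2 : regionLoss ρ ((n : ℝ) - 1 + l) (wedge (x / s) 0) ((d - x) / s) =
      ∫⁻ v, ∫⁻ z, W (z, v) := by
    rw [regionLoss, ← lintegral_indicator (measurableSet_wedge _ _), lintegral_kernelMeasure,
      ← lintegral_indicator measurableSet_sampleSpace, ← lintegral_prod_symm' _ hWm,
      ← Measure.volume_eq_prod]
    refine lintegral_congr fun p => ?_
    by_cases h1 : p ∈ sampleSpace <;> by_cases h2 : p ∈ wedge (x / s) 0 <;> simp [hW, h1, h2]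
  have h3 : ∫⁻ σ, ∫⁻ μ, G (μ, σ) = ∫⁻ σ in Ioi 0, ∫⁻ μ, G (μ, σ) := by
    rw [← lintegral_indicator measurableSet_Ioi]
    refine lintegral_congr fun σ => ?_
    by_cases hσ : 0 < σ
    · rw [indicator_of_mem (show σ ∈ Ioi 0 from hσ)]
    · rw [indicator_of_notMem (show σ ∉ Ioi 0 from hσ)]
      refine (lintegral_congr fun μ => ?_).trans lintegral_zero
      exact indicator_of_notMem (fun h => hσ h.2) _
  have h4 : ∫⁻ v, ∫⁻ z, W (z, v) = ∫⁻ v in Ioi 0, ∫⁻ z, W (z, v) := by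
    rw [← lintegral_indicator measurableSet_Ioi]
    refine lintegral_congr fun v => ?_
    by_cases hv : 0 < v
    · rw [indicator_of_mem (show v ∈ Ioi 0 from hv)]
    · rw [indicator_of_notMem (show v ∉ Ioi 0 from hv)]
      refine (lintegral_congr fun z => ?_).trans lintegral_zero
      exact indicator_of_notMem (fun h => hv h.1) _
  rw [h1, h2, h3, h4, lintegral_Ioi_comp_div hs, ← lintegral_const_mul' _ _ ENNReal.ofReal_ne_top]
  refine setLIntegral_congr_fun measurableSet_Ioi fun v hv => ?_
  have hv : 0 < v := hv
  have hsv : 0 < s / v := by positivity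
  rw [lintegral_location hsv x, ← mul_assoc, ← ENNReal.ofReal_mul (by positivity),
    ← lintegral_const_mul' _ _ ENNReal.ofReal_ne_top,
    ← lintegral_const_mul' _ _ ENNReal.ofReal_ne_top]
  refine lintegral_congr fun z => ?_
  have hmem : (x - s / v * z, s / v) ∈ paramSpace ↔ (z, v) ∈ sampleSpace ∩ wedge (x / s) 0 := by
    have e : 0 ≤ x - s / v * z ↔ z + 0 ≤ x / s * v := by
      rw [add_zero, sub_nonneg, div_mul_eq_mul_div, div_mul_eq_mul_div, div_le_iff₀ hv,
        le_div_iff₀ hs, mul_comm s z]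
    exact ⟨fun h => ⟨hv, e.1 h.1⟩, fun h => ⟨e.2 h.2, hsv⟩⟩
  by_cases hz : (z, v) ∈ sampleSpace ∩ wedge (x / s) 0
  · rw [hG, hW, indicator_of_mem hz, indicator_of_mem (hmem.2 hz)]
    simp only []
    have e1 : (d - (x - s / v * z)) / (s / v) = z + (d - x) / s * v := by field_simp; ring
    have e2 : (x - (x - s / v * z)) / (s / v) = z := by field_simp; ring
    have e3 : s / (s / v) = v := by field_simp
    have hM := modelConst_pos hn
    have hprod : ∀ a b c d r : ℝ, 0 ≤ a → 0 ≤ c → a * b = c * d →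
        ENNReal.ofReal a * (ENNReal.ofReal r * ENNReal.ofReal b) =
          ENNReal.ofReal c * (ENNReal.ofReal d * ENNReal.ofReal r) := fun a b c d r ha hc h => by
      rw [mul_left_comm, ← ENNReal.ofReal_mul ha, h, ENNReal.ofReal_mul hc, mul_left_comm,
        mul_comm (ENNReal.ofReal r)]
    rw [e1]
    refine hprod _ _ _ _ _ (by positivity) (by positivity) ?_
    simp only [modelPDF, e2, e3]
    rw [mul_assoc (1 / (s / v) ^ 2), gaussian_mul_chi hn, Real.div_rpow hs.le hv.le,
      Real.rpow_add hv, Real.rpow_neg hv.le, Real.rpow_add_one hv.ne']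
    field_simp
  · rw [hG, hW, indicator_of_notMem hz, indicator_of_notMem (fun h => hz (hmem.1 h))]
    simp

lemma IsGenBayes.isOptimal (hρ : IsConvexLoss ρ) (hn : 1 ≤ n) {δ : ℝ × ℝ → ℝ}
    (hδ : IsGenBayes n ρ l δ) (x : ℝ) (hs : 0 < s) :
    IsOptimal ρ ((n : ℝ) - 1 + l) (wedge (x / s) 0) ((δ (x, s) - x) / s) := by
  obtain ⟨h1, h2⟩ := hδ (x, s) hs
  have hK : ENNReal.ofReal (modelConst n * s ^ (-(l + 1))) ≠ 0 := by
    have := modelConst_pos hn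
    simp only [ne_eq, ENNReal.ofReal_eq_zero, not_le]
    positivity
  rw [posteriorLoss_eq hρ hn l x hs] at h1
  refine ⟨?_, fun d => ?_⟩
  · by_contra hcon
    rw [not_lt, top_le_iff] at hcon
    rw [hcon, ENNReal.mul_top hK] at h1
    exact lt_irrefl _ h1
  · have := h2 (x + d * s)
    rw [posteriorLoss_eq hρ hn l x hs, posteriorLoss_eq hρ hn l x hs,
      ENNReal.mul_le_mul_iff_right hK ENNReal.ofReal_ne_top, add_sub_cancel_left,
      mul_div_cancel_right₀ _ hs.ne'] at this
    exact this

lemma IsMRE.regionLoss_lt (hn : 1 ≤ n) (h : IsMRE n ρ c₀) (hc : c ≠ c₀) :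
    regionLoss ρ ((n : ℝ) - 1) univ c₀ < regionLoss ρ ((n : ℝ) - 1) univ c := by
  have := h c hc
  rwa [risk_equivariant hn _ _ one_pos, risk_equivariant hn _ _ one_pos,
    ENNReal.mul_lt_mul_iff_right (by simpa using modelConst_pos hn) ENNReal.ofReal_ne_top] at this

lemma IsMRE.isOptimal (hn : 1 ≤ n) (h : IsMRE n ρ c₀) :
    IsOptimal ρ ((n : ℝ) - 1) univ c₀ := by
  refine ⟨(h.regionLoss_lt hn (show c₀ + 1 ≠ c₀ by simp)).trans_le le_top, fun d => ?_⟩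
  rcases eq_or_ne d c₀ with rfl | hd
  · exact le_rfl
  · exact (h.regionLoss_lt hn hd).le

end

/-! ### Lower bound for the worst-case risk -/

section

variable {ρ q : ℝ → ℝ} {m c c₀ b j M : ℝ} {δ : ℝ × ℝ → ℝ} {r : ℝ≥0∞} {n : ℕ}

/-- The loss of `δ` at the parameter `(μ, exp τ)` and the standardized observation `p`. -/
def groupLoss (ρ : ℝ → ℝ) (δ : ℝ × ℝ → ℝ) (τ μ : ℝ) (p : ℝ × ℝ) : ℝ≥0∞ :=
  ENNReal.ofReal (ρ ((δ (μ + Real.exp τ * p.1, Real.exp τ * p.2) - μ) / Real.exp τ))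

/-- The coefficient of the equivariant estimator that agrees with `δ` at `(x, exp τ)`. -/
def localCoefficient (δ : ℝ × ℝ → ℝ) (τ x : ℝ) : ℝ := (δ (x, Real.exp τ) - x) / Real.exp τ

/-- The compact truncation of the standardized sample space. -/
def truncation (j : ℝ) : Set (ℝ × ℝ) := Icc (-j) j ×ˢ Icc j⁻¹ j

lemma measurableSet_truncation (j : ℝ) : MeasurableSet (truncation j) :=
  measurableSet_Icc.prod measurableSet_Icc

/-- For fixed standardized p the parameters (τ - log v, x - σz) are those with observation (x, exp
τ). There `δ` acts as an equivariant estimator whose coefficient does not depend on p. -/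
lemma groupLoss_translate (τ x : ℝ) {p : ℝ × ℝ} (hp : 0 < p.2) :
    groupLoss ρ δ (τ - Real.log p.2) (x - Real.exp (τ - Real.log p.2) * p.1) p =
      ENNReal.ofReal (ρ (p.1 + localCoefficient δ τ x * p.2)) := by
  have he : Real.exp (τ - Real.log p.2) = Real.exp τ / p.2 := by
    rw [Real.exp_sub, Real.exp_log hp]
  have h0 := Real.exp_pos τ
  unfold groupLoss localCoefficient
  rw [sub_add_cancel, he, div_mul_cancel₀ _ hp.ne']
  congr 2
  field_simp
  ring

/-- On the truncation |log v| ≤ log j and |σz| ≤ exp(b) j, so every observation in the shrunken box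
comes from a parameter in the original box. -/
lemma lintegral_inner_box_le (hj : 1 ≤ j) {p : ℝ × ℝ} (hp : p ∈ truncation j) :
    ∫⁻ τ in Icc (-b + Real.log j) (b - Real.log j), ∫⁻ x in Icc (Real.exp b * j)
        (M - Real.exp b * j), ENNReal.ofReal (ρ (p.1 + localCoefficient δ τ x * p.2)) ≤
      ∫⁻ τ in Icc (-b) b, ∫⁻ μ in Icc 0 M, groupLoss ρ δ τ μ p := by
  have hj0 : 0 < j := by linarith
  have hv : 0 < p.2 := lt_of_lt_of_le (inv_pos.2 hj0) hp.2.1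
  have hlog1 : Real.log p.2 ≤ Real.log j := Real.log_le_log hv hp.2.2
  have hlog2 : -Real.log j ≤ Real.log p.2 := by
    rw [← Real.log_inv]; exact Real.log_le_log (inv_pos.2 hj0) hp.2.1
  rw [← lintegral_indicator measurableSet_Icc, ← lintegral_indicator measurableSet_Icc,
    ← lintegral_sub_right_eq_self ((Icc (-b) b).indicator _) (Real.log p.2)]
  refine lintegral_mono fun τ => ?_
  by_cases hτ : τ ∈ Icc (-b + Real.log j) (b - Real.log j)
  swap
  · rw [indicator_of_notMem hτ]; exact zero_le
  have hτ' : τ - Real.log p.2 ∈ Icc (-b) b := ⟨by linarith [hτ.1], by linarith [hτ.2]⟩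
  rw [indicator_of_mem hτ, indicator_of_mem hτ', ← lintegral_indicator measurableSet_Icc,
    ← lintegral_indicator measurableSet_Icc,
    ← lintegral_sub_right_eq_self ((Icc 0 M).indicator _) (Real.exp (τ - Real.log p.2) * p.1)]
  refine lintegral_mono fun x => ?_
  by_cases hx : x ∈ Icc (Real.exp b * j) (M - Real.exp b * j)
  swap
  · rw [indicator_of_notMem hx]; exact zero_le
  have habs : |Real.exp (τ - Real.log p.2) * p.1| ≤ Real.exp b * j := by
    rw [abs_mul, abs_of_pos (Real.exp_pos _)]
    exact mul_le_mul (Real.exp_le_exp.2 hτ'.2) (abs_le.2 hp.1) (abs_nonneg _) (Real.exp_pos _).le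
  rw [abs_le] at habs
  have hx' : x - Real.exp (τ - Real.log p.2) * p.1 ∈ Icc 0 M :=
    ⟨by linarith [hx.1], by linarith [hx.2]⟩
  rw [indicator_of_mem hx, indicator_of_mem hx', groupLoss_translate τ x hv]

lemma measurable_groupLoss (hρ : IsConvexLoss ρ) (hδ : Measurable δ) :
    Measurable fun r : (ℝ × ℝ) × (ℝ × ℝ) => groupLoss ρ δ r.2.1 r.2.2 r.1 := by
  unfold groupLoss
  refine (hρ.measurable.comp (Measurable.div (Measurable.sub (hδ.comp ?_) ?_) ?_)).ennreal_ofReal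
  all_goals fun_prop

lemma measurable_localLoss (hρ : IsConvexLoss ρ) (hδ : Measurable δ) :
    Measurable fun r : (ℝ × ℝ) × (ℝ × ℝ) =>
      ENNReal.ofReal (ρ (r.1.1 + localCoefficient δ r.2.1 r.2.2 * r.1.2)) := by
  unfold localCoefficient
  refine (hρ.measurable.comp (Measurable.add (by fun_prop)
    (Measurable.mul (Measurable.div (Measurable.sub (hδ.comp ?_) ?_) ?_) ?_))).ennreal_ofReal
  all_goals fun_prop

lemma lintegral_swap_triple {ν : Measure (ℝ × ℝ)} [SFinite ν] {S T : Set ℝ}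
    {F : (ℝ × ℝ) → ℝ → ℝ → ℝ≥0∞}
    (hF : Measurable fun r : (ℝ × ℝ) × (ℝ × ℝ) => F r.1 r.2.1 r.2.2) :
    ∫⁻ p, (∫⁻ τ in S, ∫⁻ x in T, F p τ x) ∂ν = ∫⁻ τ in S, ∫⁻ x in T, ∫⁻ p, F p τ x ∂ν := by
  rw [lintegral_lintegral_swap]
  · refine lintegral_congr fun τ => ?_
    rw [lintegral_lintegral_swap]
    exact (hF.comp (f := fun r : (ℝ × ℝ) × ℝ => (r.1, (τ, r.2))) (by fun_prop)).aemeasurable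
  · have : Measurable fun r : ((ℝ × ℝ) × ℝ) × ℝ => F r.1.1 r.1.2 r.2 :=
      hF.comp (f := fun r : ((ℝ × ℝ) × ℝ) × ℝ => (r.1.1, (r.1.2, r.2))) (by fun_prop)
    exact this.lintegral_prod_right'.aemeasurable

/-- The box prior bounds the truncated Bayes risk. -/
lemma iInf_truncation_mul_le (hρ : IsConvexLoss ρ) (hδ : Measurable δ)
    (hr : ∀ τ μ, 0 ≤ μ → ∫⁻ p, groupLoss ρ δ τ μ p ∂kernelMeasure m ≤ r) (hj : 1 ≤ j) :
    (⨅ c, regionLoss ρ m (truncation j) c) * volume (Icc (Real.exp b * j) (M - Real.exp b * j)) *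
        volume (Icc (-b + Real.log j) (b - Real.log j)) ≤
      r * volume (Icc 0 M) * volume (Icc (-b) b) := by
  calc _ = ∫⁻ _ in Icc (-b + Real.log j) (b - Real.log j), ∫⁻ _ in Icc (Real.exp b * j)
        (M - Real.exp b * j), (⨅ c, regionLoss ρ m (truncation j) c) := by
        rw [setLIntegral_const, setLIntegral_const]
    _ ≤ ∫⁻ τ in Icc (-b + Real.log j) (b - Real.log j), ∫⁻ x in Icc (Real.exp b * j)
        (M - Real.exp b * j), regionLoss ρ m (truncation j) (localCoefficient δ τ x) :=
        lintegral_mono fun τ => lintegral_mono fun x => iInf_le _ _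
    _ = ∫⁻ p in truncation j, (∫⁻ τ in Icc (-b + Real.log j) (b - Real.log j),
        ∫⁻ x in Icc (Real.exp b * j) (M - Real.exp b * j),
          ENNReal.ofReal (ρ (p.1 + localCoefficient δ τ x * p.2))) ∂kernelMeasure m := by
        rw [lintegral_swap_triple (measurable_localLoss hρ hδ)]
        rfl
    _ ≤ ∫⁻ p in truncation j, (∫⁻ τ in Icc (-b) b, ∫⁻ μ in Icc 0 M, groupLoss ρ δ τ μ p)
          ∂kernelMeasure m :=
        setLIntegral_mono' (measurableSet_truncation j) fun p hp => lintegral_inner_box_le hj hp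
    _ ≤ ∫⁻ p, (∫⁻ τ in Icc (-b) b, ∫⁻ μ in Icc 0 M, groupLoss ρ δ τ μ p) ∂kernelMeasure m :=
        setLIntegral_le_lintegral _ _
    _ = ∫⁻ τ in Icc (-b) b, ∫⁻ μ in Icc 0 M, ∫⁻ p, groupLoss ρ δ τ μ p ∂kernelMeasure m :=
        lintegral_swap_triple (F := fun p τ μ => groupLoss ρ δ τ μ p) (measurable_groupLoss hρ hδ)
    _ ≤ ∫⁻ _ in Icc (-b) b, ∫⁻ _ in Icc 0 M, r :=
        lintegral_mono fun τ => setLIntegral_mono' measurableSet_Icc fun μ hμ => hr τ μ hμ.1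
    _ = _ := by rw [setLIntegral_const, setLIntegral_const]

lemma iInf_truncation_le (hρ : IsConvexLoss ρ) (hδ : Measurable δ)
    (hr : ∀ τ μ, 0 ≤ μ → ∫⁻ p, groupLoss ρ δ τ μ p ∂kernelMeasure m ≤ r) (hj : 1 ≤ j) :
    ⨅ c, regionLoss ρ m (truncation j) c ≤ r := by
  set I := ⨅ c, regionLoss ρ m (truncation j) c
  have key : ∀ᶠ b : ℝ in atTop, I * ENNReal.ofReal ((1 - 1 / b) * (1 - Real.log j / b)) ≤ r := by
    filter_upwards [eventually_gt_atTop (1 + Real.log j)] with b hb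
    have hlog := Real.log_nonneg hj
    have hb0 : 0 < b := by linarith
    set e := Real.exp b * j with he
    have he0 : 0 < e := mul_pos (Real.exp_pos b) (by linarith)
    -- This M makes the inner box a fraction 1 - 1/b of the outer one in location; the fraction in
    -- log scale is 1 - log j / b. Both tend to 1.
    have h := iInf_truncation_mul_le (b := b) (M := 2 * e * b) hρ hδ hr hj
    rw [Real.volume_Icc, Real.volume_Icc, Real.volume_Icc, Real.volume_Icc, mul_assoc, mul_assoc r,
      ← he, ← ENNReal.ofReal_mul (by nlinarith), ← ENNReal.ofReal_mul (by nlinarith)] at h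
    have e1 : (2 * e * b - e - e) * (b - Real.log j - (-b + Real.log j)) =
        (1 - 1 / b) * (1 - Real.log j / b) * (4 * e * b ^ 2) := by field_simp; ring
    have e2 : (2 * e * b - 0) * (b - -b) = 4 * e * b ^ 2 := by ring
    have hpos : 0 < 4 * e * b ^ 2 := by positivity
    rw [e1, e2, ENNReal.ofReal_mul' hpos.le, ← mul_assoc] at h
    exact (ENNReal.mul_le_mul_iff_left (by simpa using hpos) ENNReal.ofReal_ne_top).1 h
  have hlim : Tendsto (fun b : ℝ => (1 - 1 / b) * (1 - Real.log j / b)) atTop (𝓝 1) := by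
    have h1 := tendsto_const_nhds (x := (1 : ℝ)).sub
      (tendsto_const_nhds (x := (1 : ℝ)).div_atTop tendsto_id)
    have h2 := tendsto_const_nhds (x := (1 : ℝ)).sub
      (tendsto_const_nhds (x := Real.log j).div_atTop tendsto_id)
    simpa using h1.mul h2
  have hlim' := ENNReal.Tendsto.const_mul (a := I) (ENNReal.tendsto_ofReal hlim) (Or.inl (by simp))
  rw [ENNReal.ofReal_one, mul_one] at hlim'
  exact le_of_tendsto hlim' key

lemma IsSubderivative.exists_coercive (hρ : IsConvexLoss ρ) (hq : IsSubderivative ρ q) :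
    ∃ κ > 0, ∀ u, κ * (|u| - 1) ≤ ρ u := by
  refine ⟨min (q 1) (-q (-1)), lt_min (hq.pos_of_pos 1 one_pos)
    (by linarith [hq.neg_of_neg (-1) (by norm_num)]), fun u => ?_⟩
  rcases le_or_gt |u| 1 with h | h
  · have h1 : 0 < min (q 1) (-q (-1)) := lt_min (hq.pos_of_pos 1 one_pos)
      (by linarith [hq.neg_of_neg (-1) (by norm_num)])
    nlinarith [hρ.nonneg u]
  rcases le_total 0 u with hu | hu
  · rw [abs_of_nonneg hu] at h ⊢
    have h1 := hq.subgradient 1 u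
    have h2 := min_le_left (q 1) (-q (-1))
    nlinarith [hρ.nonneg 1]
  · rw [abs_of_nonpos hu] at h ⊢
    have h1 := hq.subgradient (-1) u
    have h2 := min_le_right (q 1) (-q (-1))
    nlinarith [hρ.nonneg (-1)]

lemma bounded_of_truncation_le (hρ : IsConvexLoss ρ) (hq : IsSubderivative ρ q) (hr : r < ∞) :
    ∃ C, ∀ c, regionLoss ρ m (truncation 2) c ≤ r → |c| ≤ C := by
  obtain ⟨κ, hκ, hcoer⟩ := hq.exists_coercive hρ
  have hK : kernelMeasure m (truncation 2) ≠ 0 := by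
    have hU : IsOpen (Ioo (-2 : ℝ) 2 ×ˢ Ioo (2⁻¹ : ℝ) 2) := isOpen_Ioo.prod isOpen_Ioo
    have := kernelMeasure_ne_zero m hU ⟨(0, 1), by norm_num⟩ fun p hp => by
      have : (2⁻¹ : ℝ) < p.2 := hp.2.1
      change 0 < p.2
      linarith
    exact fun h0 => this (measure_mono_null
      (prod_mono Ioo_subset_Icc_self Ioo_subset_Icc_self) h0)
  have hT : r / kernelMeasure m (truncation 2) ≠ ∞ := (ENNReal.div_lt_top hr.ne hK).ne
  refine ⟨2 * ((r / kernelMeasure m (truncation 2)).toReal / κ + 3), fun c hc => ?_⟩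
  have h1 : ENNReal.ofReal (κ * (|c| / 2 - 3)) * kernelMeasure m (truncation 2) ≤ r := by
    refine le_trans ?_ hc
    rw [← setLIntegral_const]
    refine setLIntegral_mono' (measurableSet_truncation 2) fun p hp => ?_
    refine ENNReal.ofReal_le_ofReal (le_trans ?_ (hcoer _))
    have h2 : |p.1| ≤ 2 := abs_le.2 hp.1
    have h3 : 2⁻¹ ≤ p.2 := hp.2.1
    have h4 : |c * p.2| ≤ |p.1 + c * p.2| + |p.1| := by
      have := abs_sub (p.1 + c * p.2) p.1
      rwa [add_sub_cancel_left] at this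
    rw [abs_mul, abs_of_nonneg (by linarith : 0 ≤ p.2)] at h4
    have h5 : |c| / 2 ≤ |c| * p.2 := by nlinarith [abs_nonneg c]
    exact mul_le_mul_of_nonneg_left (by linarith) hκ.le
  have h2 : κ * (|c| / 2 - 3) ≤ (r / kernelMeasure m (truncation 2)).toReal := by
    refine (ENNReal.ofReal_le_iff_le_toReal hT).1 ?_
    rw [ENNReal.le_div_iff_mul_le (Or.inl hK) (Or.inr hr.ne)]
    exact h1
  have h3 : |c| / 2 - 3 ≤ (r / kernelMeasure m (truncation 2)).toReal / κ := by
    rw [le_div_iff₀ hκ]; linarith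
  linarith

lemma truncation_mono {i j : ℝ} (hi : 0 < i) (hij : i ≤ j) : truncation i ⊆ truncation j :=
  prod_mono (Icc_subset_Icc (by linarith) hij) (Icc_subset_Icc (inv_anti₀ hi hij) hij)

/-- Coercivity of ρ on a fixed truncation confines the coefficients to a compact interval; a
subsequential limit works by Fatou's lemma. -/
lemma exists_regionLoss_le (hρ : IsConvexLoss ρ) (hq : IsSubderivative ρ q) (hr : r < ∞)
    (h : ∀ j : ℝ, 1 ≤ j → ∃ c, regionLoss ρ m (truncation j) c ≤ r) :
    ∃ c, regionLoss ρ m univ c ≤ r := by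
  obtain ⟨C, hC⟩ := bounded_of_truncation_le (m := m) hρ hq hr
  choose! c hc using h
  set d : ℕ → ℝ := fun k => c ((k : ℝ) + 2) with hd
  have hdr : ∀ k : ℕ, regionLoss ρ m (truncation ((k : ℝ) + 2)) (d k) ≤ r := fun k =>
    hc _ (by have : (0 : ℝ) ≤ k := k.cast_nonneg
             linarith)
  have hdC : ∀ k, d k ∈ Metric.closedBall (0 : ℝ) C := fun k => by
    rw [mem_closedBall_zero_iff, Real.norm_eq_abs]
    refine hC _ (le_trans ?_ (hdr k))
    refine lintegral_mono' (Measure.restrict_mono (truncation_mono two_pos ?_) le_rfl) le_rfl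
    have : (0 : ℝ) ≤ k := k.cast_nonneg
    linarith
  obtain ⟨a, -, φ, hφ, ha⟩ := tendsto_subseq_of_bounded Metric.isBounded_closedBall hdC
  refine ⟨a, ?_⟩
  set F : ℕ → ℝ × ℝ → ℝ≥0∞ := fun k => (truncation ((φ k : ℝ) + 2)).indicator fun p =>
    ENNReal.ofReal (ρ (p.1 + d (φ k) * p.2)) with hF
  have hFm : ∀ k, Measurable (F k) := fun k =>
    (measurable_loss hρ _).indicator (measurableSet_truncation _)
  have hlim : ∀ᵐ p ∂kernelMeasure m,
      liminf (fun k => F k p) atTop = ENNReal.ofReal (ρ (p.1 + a * p.2)) := by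
    filter_upwards [ae_kernelMeasure_snd_pos m] with p hp
    refine Tendsto.liminf_eq ?_
    have h1 : Tendsto (fun k => ENNReal.ofReal (ρ (p.1 + d (φ k) * p.2))) atTop
        (𝓝 (ENNReal.ofReal (ρ (p.1 + a * p.2)))) :=
      ENNReal.tendsto_ofReal ((hρ.continuous.tendsto _).comp
        (tendsto_const_nhds.add (ha.mul_const _)))
    refine h1.congr' ?_
    have hbig : Tendsto (fun k => (φ k : ℝ) + 2) atTop atTop :=
      (tendsto_natCast_atTop_atTop.comp hφ.tendsto_atTop).atTop_add tendsto_const_nhds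
    filter_upwards [hbig.eventually_ge_atTop |p.1|, hbig.eventually_ge_atTop p.2,
      hbig.eventually_ge_atTop p.2⁻¹] with k h1 h2 h3
    have hmem : p ∈ truncation ((φ k : ℝ) + 2) :=
      ⟨abs_le.1 h1, inv_le_of_inv_le₀ hp h3, h2⟩
    exact (indicator_of_mem hmem fun p : ℝ × ℝ => ENNReal.ofReal (ρ (p.1 + d (φ k) * p.2))).symm
  unfold regionLoss
  rw [Measure.restrict_univ, ← lintegral_congr_ae hlim]
  refine (lintegral_liminf_le hFm).trans ?_
  refine liminf_le_of_frequently_le' (Frequently.of_forall fun k => ?_)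
  rw [hF]
  dsimp only
  rw [lintegral_indicator (measurableSet_truncation _)]
  exact hdr (φ k)

lemma le_of_forall_groupLoss_le (hρ : IsConvexLoss ρ) (hq : IsSubderivative ρ q)
    (hc : IsOptimal ρ m univ c₀) (hδ : Measurable δ)
    (hr : ∀ τ μ, 0 ≤ μ → ∫⁻ p, groupLoss ρ δ τ μ p ∂kernelMeasure m ≤ r) :
    regionLoss ρ m univ c₀ ≤ r := by
  refine le_of_forall_gt_imp_ge_of_dense fun r' hr' => ?_
  rcases eq_or_ne r' ∞ with rfl | htop
  · exact le_top
  obtain ⟨c, hcr⟩ := exists_regionLoss_le (m := m) hρ hq (lt_top_iff_ne_top.2 htop) fun j hj => by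
    have := (iInf_truncation_le (m := m) hρ hδ hr hj).trans_lt hr'
    obtain ⟨c, hc⟩ := iInf_lt_iff.1 this
    exact ⟨c, hc.le⟩
  exact (hc.2 c).trans hcr

/-- The risk of the minimum risk equivariant estimator is a lower bound for the worst-case
risk. -/
lemma le_maxRisk (hρ : IsConvexLoss ρ) (hn : 1 ≤ n) (hc₀ : IsMRE n ρ c₀) (hδ : IsEstimator δ) :
    ENNReal.ofReal (modelConst n) * regionLoss ρ ((n : ℝ) - 1) univ c₀ ≤ maxRisk n ρ δ := by
  -- An estimator is measurable only on the sample space; extending it by 0 changes no risk.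
  set δ' : ℝ × ℝ → ℝ := sampleSpace.indicator δ with hδ'
  have hm : Measurable δ' := by
    rw [hδ']
    refine measurable_of_restrict_of_restrict_compl measurableSet_sampleSpace ?_ ?_
    · rw [show sampleSpace.domRestrict (sampleSpace.indicator δ) = sampleSpace.domRestrict δ from
        funext fun p => indicator_of_mem p.2 δ]
      exact hδ
    · rw [show sampleSpaceᶜ.domRestrict (sampleSpace.indicator δ) = fun _ => 0 from
        funext fun p => indicator_of_notMem p.2 δ]
      exact measurable_const
  have hK0 : ENNReal.ofReal (modelConst n) ≠ 0 := by simpa using modelConst_pos hn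
  rw [mul_comm, ← ENNReal.le_div_iff_mul_le (Or.inl hK0) (Or.inl ENNReal.ofReal_ne_top)]
  refine le_of_forall_groupLoss_le hρ hρ.isSubderivative (hc₀.isOptimal hn) hm fun τ μ hμ => ?_
  rw [ENNReal.le_div_iff_mul_le (Or.inl hK0) (Or.inl ENNReal.ofReal_ne_top), mul_comm]
  refine le_trans (le_of_eq ?_) (le_iSup₂ (f := fun (θ : ℝ × ℝ) (_ : θ ∈ paramSpace) =>
    risk n ρ δ θ.1 θ.2) (μ, Real.exp τ) ⟨hμ, Real.exp_pos τ⟩)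
  rw [risk_eq hn _ _ (Real.exp_pos τ)]
  congr 1
  refine lintegral_congr_ae ?_
  filter_upwards [ae_kernelMeasure_snd_pos ((n : ℝ) - 1)] with p hp
  have hmem : (μ + Real.exp τ * p.1, Real.exp τ * p.2) ∈ sampleSpace :=
    mul_pos (Real.exp_pos τ) hp
  rw [groupLoss, hδ', indicator_of_mem hmem]

end

/-! ### Even losses and assembly of the results -/

section

variable {ρ : ℝ → ℝ} {m m' c c₀ : ℝ} {n : ℕ}

lemma lintegral_kernelMeasure_iterated (m : ℝ) {F : ℝ × ℝ → ℝ≥0∞} (hF : Measurable F) :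
    ∫⁻ p, F p ∂kernelMeasure m = ∫⁻ v in Ioi 0, ENNReal.ofReal (v ^ m * Real.exp (-v ^ 2 / 2)) *
      ∫⁻ z, ENNReal.ofReal (Real.exp (-z ^ 2 / 2)) * F (z, v) := by
  have hset : sampleSpace = univ ×ˢ Ioi 0 := by ext p; simp [sampleSpace]
  have hm : Measurable fun p : ℝ × ℝ =>
      ENNReal.ofReal (p.2 ^ m * Real.exp (-(p.1 ^ 2 + p.2 ^ 2) / 2)) * F p :=
    (measurable_kernel m).mul hF
  rw [lintegral_kernelMeasure, hset, Measure.volume_eq_prod, ← Measure.prod_restrict,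
    Measure.restrict_univ, lintegral_prod_symm' _ hm]
  refine lintegral_congr fun v => ?_
  rw [← lintegral_const_mul' _ _ ENNReal.ofReal_ne_top]
  refine lintegral_congr fun z => ?_
  rw [← mul_assoc, ← ENNReal.ofReal_mul' (Real.exp_pos _).le, mul_assoc, ← Real.exp_add]
  ring_nf

lemma regionLoss_neg (hρ : IsConvexLoss ρ) (heven : Function.Even ρ) (m c : ℝ) :
    regionLoss ρ m univ (-c) = regionLoss ρ m univ c := by
  unfold regionLoss
  rw [Measure.restrict_univ, lintegral_kernelMeasure_iterated m (measurable_loss hρ _),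
    lintegral_kernelMeasure_iterated m (measurable_loss hρ _)]
  refine lintegral_congr fun v => ?_
  rw [← lintegral_neg_eq_self]
  congr 1
  refine lintegral_congr fun z => ?_
  rw [show -z + -c * v = -(z + c * v) by ring, heven, neg_sq]

/-- Convexity applied to the midpoint of d and -d, whose losses agree by symmetry in z. -/
lemma regionLoss_zero_le (hρ : IsConvexLoss ρ) (heven : Function.Even ρ) (m d : ℝ) :
    regionLoss ρ m univ 0 ≤ regionLoss ρ m univ d := by
  have h : 2 * regionLoss ρ m univ 0 ≤ 2 * regionLoss ρ m univ d := by
    calc _ ≤ regionLoss ρ m univ d + regionLoss ρ m univ (-d) := by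
          unfold regionLoss
          rw [← lintegral_const_mul' _ _ (by norm_num), ← lintegral_add_left (measurable_loss hρ d)]
          refine lintegral_mono fun p => ?_
          have h := hρ.convex.2 (mem_univ (p.1 + d * p.2)) (mem_univ (p.1 + -d * p.2))
            (show (0 : ℝ) ≤ 1 / 2 by norm_num) (show (0 : ℝ) ≤ 1 / 2 by norm_num) (by norm_num)
          simp only [smul_eq_mul] at h
          rw [show 1 / 2 * (p.1 + d * p.2) + 1 / 2 * (p.1 + -d * p.2) = p.1 + 0 * p.2 by ring] at h
          dsimp only
          rw [← ENNReal.ofReal_add (hρ.nonneg _) (hρ.nonneg _),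
            show (2 : ℝ≥0∞) = ENNReal.ofReal 2 by simp, ← ENNReal.ofReal_mul zero_le_two]
          exact ENNReal.ofReal_le_ofReal (by linarith)
      _ = 2 * regionLoss ρ m univ d := by rw [regionLoss_neg hρ heven, two_mul]
  exact (ENNReal.mul_le_mul_iff_right two_ne_zero (by norm_num)).1 h

lemma regionLoss_zero_eq (hρ : IsConvexLoss ρ) (m : ℝ) :
    regionLoss ρ m univ 0 = (∫⁻ v in Ioi 0, ENNReal.ofReal (v ^ m * Real.exp (-v ^ 2 / 2))) *
      ∫⁻ z, ENNReal.ofReal (Real.exp (-z ^ 2 / 2)) * ENNReal.ofReal (ρ z) := by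
  unfold regionLoss
  rw [Measure.restrict_univ, lintegral_kernelMeasure_iterated m (measurable_loss hρ _),
    ← lintegral_mul_const _ (by fun_prop)]
  simp

/-- At c = 0 the integral factors into a scale part and a location part, and only the scale part
depends on the power. -/
lemma regionLoss_zero_lt_top (hρ : IsConvexLoss ρ) (hm' : -1 < m')
    (h : regionLoss ρ m univ 0 < ∞) : regionLoss ρ m' univ 0 < ∞ := by
  rw [regionLoss_zero_eq hρ] at h ⊢
  have h0 : ∫⁻ v in Ioi (0 : ℝ), ENNReal.ofReal (v ^ m * Real.exp (-v ^ 2 / 2)) ≠ 0 := by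
    rw [ne_eq, lintegral_eq_zero_iff (by fun_prop)]
    intro h0
    have h1 := (ae_restrict_iff' measurableSet_Ioi).1 h0
    refine (isOpen_Ioi.measure_pos (volume : Measure ℝ) ⟨1, one_pos⟩).ne'
      (measure_mono_null (fun v (hv : 0 < v) => ?_) (ae_iff.1 h1))
    simp only [mem_ofPred_eq, Pi.zero_apply, ENNReal.ofReal_eq_zero, Classical.not_imp, not_le]
    exact ⟨hv, by positivity⟩
  have hfin : ∫⁻ z : ℝ, ENNReal.ofReal (Real.exp (-z ^ 2 / 2)) * ENNReal.ofReal (ρ z) < ∞ := by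
    refine lt_top_iff_ne_top.2 fun h1 => ?_
    rw [h1, ENNReal.mul_top h0] at h
    exact lt_irrefl _ h
  refine ENNReal.mul_lt_top ?_ hfin
  have hint := (integrableOn_rpow_mul_exp_neg_mul_sq (b := 1 / 2) (by norm_num) hm').2
  refine lt_of_eq_of_lt (setLIntegral_congr_fun measurableSet_Ioi fun v hv => ?_) hint
  have hv : 0 < v := hv
  dsimp only
  rw [Real.enorm_of_nonneg (by positivity)]
  ring_nf

lemma IsMRE.eq_zero (hρ : IsConvexLoss ρ) (hn : 1 ≤ n) (heven : Function.Even ρ)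
    (h : IsMRE n ρ c₀) : c₀ = 0 := by
  by_contra hne
  exact (h.regionLoss_lt hn (Ne.symm hne)).not_ge (regionLoss_zero_le hρ heven _ _)

/-- The power m is arbitrary above -1, so 0 is also the limit of the Bayes coefficients for every l
> 0, where the power is n - 1 + l. -/
lemma IsMRE.isOptimal_zero (hρ : IsConvexLoss ρ) (hn : 1 ≤ n) (heven : Function.Even ρ)
    (h : IsMRE n ρ c₀) (hm : -1 < m) : IsOptimal ρ m univ 0 := by
  have h0 := (h.isOptimal hn).1
  rw [h.eq_zero hρ hn heven] at h0
  exact ⟨regionLoss_zero_lt_top hρ hm h0, regionLoss_zero_le hρ heven m⟩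

variable {l : ℝ} {δ δ' : ℝ × ℝ → ℝ} {g : ℝ → ℝ}

lemma add_expansion (c₀ : ℝ) (δ : ℝ × ℝ → ℝ) (y : ℝ) : c₀ + expansion c₀ δ y = δ (y, 1) - y := by
  simp only [expansion, equivariant]
  ring

lemma IsGenBayes.isOptimal_expansion (hρ : IsConvexLoss ρ) (hn : 1 ≤ n)
    (hδ : IsGenBayes n ρ l δ) (c₀ t : ℝ) :
    IsOptimal ρ ((n : ℝ) - 1 + l) (wedge t 0) (c₀ + expansion c₀ δ t) := by
  have := hδ.isOptimal hρ hn t one_pos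
  rwa [div_one, div_one, ← add_expansion c₀] at this

lemma IsGenBayes.eq_expand (hρ : IsConvexLoss ρ) (hn : 1 ≤ n) (hδ : IsGenBayes n ρ l δ)
    (c₀ : ℝ) {p : ℝ × ℝ} (hp : p ∈ sampleSpace) : δ p = expand c₀ (expansion c₀ δ) p := by
  have hp : 0 < p.2 := hp
  have h := (hδ.isOptimal hρ hn p.1 hp).unique hρ hρ.isSubderivative
    (hδ.isOptimal_expansion hρ hn c₀ (p.1 / p.2))
  rw [div_eq_iff hp.ne'] at h
  simp only [expand, equivariant]
  linarith

lemma IsGenBayes.classC (hρ : IsConvexLoss ρ) (hpen : PenalizesOver ρ) (hn : 1 ≤ n) (hl : 0 ≤ l)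
    (hδ : IsGenBayes n ρ l δ) (hc : IsOptimal ρ ((n : ℝ) - 1 + l) univ c₀) :
    ClassC (expansion c₀ δ) := by
  have hq := hρ.isSubderivative
  have hf := hδ.isOptimal_expansion hρ hn c₀
  have hn' : (1 : ℝ) ≤ n := by exact_mod_cast hn
  refine ⟨fun a b => ?_, fun x y hxy => ?_, ?_, ?_⟩
  · have h1 := absolutelyContinuousOnInterval_of_isOptimal hρ hq (by linarith)
      (hpen.subderiv_le hρ) hf a b
    have h2 : AbsolutelyContinuousOnInterval (fun _ : ℝ => c₀) a b :=
      (LipschitzWith.const c₀).lipschitzOnWith.absolutelyContinuousOnInterval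
    convert! h1.sub h2 using 1
    ext y
    simp
  · exact le_of_add_le_add_left (antitone_of_isOptimal hρ hq hf hxy)
  · rintro ⟨k, hk⟩
    obtain ⟨t, ht⟩ := nonconstant_of_isOptimal hρ hq hf (c₀ + k)
    rw [hk] at ht
    exact lt_irrefl _ ht
  · simpa using (tendsto_of_isOptimal hρ hq hf hc).sub_const c₀

lemma ClassC.exists_ne_zero (hg : ClassC g) : ∃ y, g y ≠ 0 := by
  by_contra! h
  exact hg.nonconstant ⟨0, h⟩

lemma isEstimator_expand (c₀ : ℝ) (hg : Measurable g) : IsEstimator (expand c₀ g) := by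
  have : Measurable (expand c₀ g) := by
    unfold expand equivariant
    exact Measurable.add (by fun_prop) (Measurable.mul (hg.comp (by fun_prop)) measurable_snd)
  exact this.comp measurable_subtype_coe

lemma dominates_and_isMinimax_expand (hρ : IsConvexLoss ρ) (hpen : PenalizesOver ρ) (hn : 1 ≤ n)
    (hc₀ : IsMRE n ρ c₀) (hδ : IsGenBayes n ρ 0 δ) (hg : ClassC g)
    (hle : ∀ y, g y ≤ expansion c₀ δ y) :
    Dominates n ρ (expand c₀ g) (equivariant c₀) ∧ IsMinimax n ρ (expand c₀ g) := by
  have hq := hρ.isSubderivative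
  have hf := hδ.isOptimal_expansion hρ hn c₀
  rw [add_zero] at hf
  have hn' : (1 : ℝ) ≤ n := by exact_mod_cast hn
  have hfin := (hc₀.isOptimal hn).1
  have hrisk : ∀ θ ∈ paramSpace,
      risk n ρ (expand c₀ g) θ.1 θ.2 ≤ risk n ρ (equivariant c₀) θ.1 θ.2 := fun θ hθ => by
    rw [risk_expand hn _ _ _ hθ.2, risk_equivariant hn _ _ hθ.2]
    gcongr
    exact expandedLoss_le hρ hq (by linarith) (hpen.subderiv_le hρ) hf hg.antitone hg.tendsto_zero
      (fun y => by linarith [hle y]) hfin (div_nonneg hθ.1 hθ.2.le)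
  -- Any parameter with μ > 0 gives η > 0 and hence strict improvement; (1, 1) is one.
  refine ⟨⟨hrisk, (1, 1), ⟨zero_le_one, one_pos⟩, ?_⟩, isEstimator_expand c₀ hg.antitone.measurable,
    fun δ' hδ' => le_trans (iSup₂_le fun θ hθ => ?_) (le_maxRisk hρ hn hc₀ hδ')⟩
  · rw [risk_expand hn _ _ _ one_pos, risk_equivariant hn _ _ one_pos,
      ENNReal.mul_lt_mul_iff_right (by simpa using modelConst_pos hn) ENNReal.ofReal_ne_top]
    exact expandedLoss_lt hρ hq (by linarith) (hpen.subderiv_le hρ) hf hg.antitone hg.tendsto_zero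
      (fun y => by linarith [hle y]) hg.exists_ne_zero hfin (by norm_num)
  · rw [← risk_equivariant hn c₀ θ.1 hθ.2]
    exact hrisk θ hθ

lemma risk_congr (hn : 1 ≤ n) (h : EqOn δ δ' sampleSpace) (μ : ℝ) {σ : ℝ} (hσ : 0 < σ) :
    risk n ρ δ μ σ = risk n ρ δ' μ σ := by
  rw [risk_eq hn _ _ hσ, risk_eq hn _ _ hσ]
  congr 1
  refine lintegral_congr_ae ?_
  filter_upwards [ae_kernelMeasure_snd_pos ((n : ℝ) - 1)] with p hp
  rw [h (show (μ + σ * p.1, σ * p.2) ∈ sampleSpace from mul_pos hσ hp)]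

lemma Dominates.congr (hn : 1 ≤ n) (h : EqOn δ δ' sampleSpace) {δ₀ : ℝ × ℝ → ℝ}
    (hd : Dominates n ρ δ δ₀) : Dominates n ρ δ' δ₀ := by
  obtain ⟨h1, θ, hθ, h2⟩ := hd
  refine ⟨fun θ hθ => ?_, θ, hθ, ?_⟩
  · rw [← risk_congr hn h _ hθ.2]; exact h1 θ hθ
  · rwa [← risk_congr hn h _ hθ.2]

lemma IsMinimax.congr (hn : 1 ≤ n) (h : EqOn δ δ' sampleSpace) (hd : IsMinimax n ρ δ) :
    IsMinimax n ρ δ' := by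
  refine ⟨?_, fun δ'' h'' => le_of_eq_of_le ?_ (hd.2 δ'' h'')⟩
  · have : sampleSpace.domRestrict δ' = sampleSpace.domRestrict δ :=
      funext fun p => (h p.2).symm
    unfold IsEstimator
    rw [this]
    exact hd.1
  · exact iSup_congr fun θ => iSup_congr fun hθ => (risk_congr hn h _ hθ.2).symm

lemma IsGenBayes.dominates_and_isMinimax (hρ : IsConvexLoss ρ) (hpen : PenalizesOver ρ)
    (hn : 1 ≤ n) (hc₀ : IsMRE n ρ c₀) (hδ : IsGenBayes n ρ l δ) (hδ' : IsGenBayes n ρ 0 δ')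
    (hC : ClassC (expansion c₀ δ)) (hle : ∀ y, expansion c₀ δ y ≤ expansion c₀ δ' y) :
    Dominates n ρ δ (equivariant c₀) ∧ IsMinimax n ρ δ := by
  have heq : EqOn (expand c₀ (expansion c₀ δ)) δ sampleSpace := fun p hp =>
    (hδ.eq_expand hρ hn c₀ hp).symm
  have h := dominates_and_isMinimax_expand hρ hpen hn hc₀ hδ' hC hle
  exact ⟨h.1.congr hn heq, h.2.congr hn heq⟩

end

end NormalScale

end

open NormalScale
theorem theorem2 (n : ℕ) (hn : 1 ≤ n) (ρ : ℝ → ℝ) (hρ : IsConvexLoss ρ)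
    (c₀ : ℝ) (hc₀ : IsMRE n ρ c₀)
    (δπ₀ : ℝ × ℝ → ℝ) (hδπ₀ : IsGenBayes n ρ 0 δπ₀) :
    (PenalizesOver ρ →
      (∀ g : ℝ → ℝ, ClassC g → (∀ y, g y ≤ expansion c₀ δπ₀ y) →
        Dominates n ρ (expand c₀ g) (equivariant c₀) ∧ IsMinimax n ρ (expand c₀ g)) ∧
      (MemClassC c₀ δπ₀ ∧ Dominates n ρ δπ₀ (equivariant c₀) ∧ IsMinimax n ρ δπ₀)) ∧
    (Function.Even ρ →
      ∀ l : ℝ, 0 < l → ∀ δπ : ℝ × ℝ → ℝ, IsGenBayes n ρ l δπ →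
        MemClassC c₀ δπ ∧ (∀ y, expansion c₀ δπ y ≤ expansion c₀ δπ₀ y) ∧
        Dominates n ρ δπ (equivariant c₀) ∧ IsMinimax n ρ δπ) := by
  refine ⟨fun hpen => ⟨fun g hg hle => dominates_and_isMinimax_expand hρ hpen hn hc₀ hδπ₀ hg hle,
    ?_⟩, fun heven l hl δπ hδπ => ?_⟩
  · have hC : ClassC (expansion c₀ δπ₀) :=
      hδπ₀.classC hρ hpen hn le_rfl (by rw [add_zero]; exact hc₀.isOptimal hn)
    exact ⟨⟨hC, fun p hp => hδπ₀.eq_expand hρ hn c₀ hp⟩,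
      hδπ₀.dominates_and_isMinimax hρ hpen hn hc₀ hδπ₀ hC fun _ => le_rfl⟩
  · have hpen := penalizesOver_of_even hρ heven
    have hq := hρ.isSubderivative
    have hn' : (1 : ℝ) ≤ n := by exact_mod_cast hn
    have hc := hc₀.eq_zero hρ hn heven
    have hC : ClassC (expansion c₀ δπ) := hδπ.classC hρ hpen hn hl.le (by
      rw [hc]; exact hc₀.isOptimal_zero hρ hn heven (by linarith))
    have hle : ∀ y, expansion c₀ δπ y ≤ expansion c₀ δπ₀ y := fun y => by
      have h0 := hδπ₀.isOptimal_expansion hρ hn c₀ y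
      rw [add_zero] at h0
      -- As c₀ = 0, this makes the Bayes coefficient for l = 0 nonnegative, which the comparison of
      -- powers requires.
      have hpos := (hc₀.isOptimal hn).le_wedge hρ hq h0
      exact le_of_add_le_add_left (h0.power_le hρ hq (by linarith) hl.le (by linarith)
        (hδπ.isOptimal_expansion hρ hn c₀ y))
    exact ⟨⟨hC, fun p hp => hδπ.eq_expand hρ hn c₀ hp⟩, hle,
      hδπ.dominates_and_isMinimax hρ hpen hn hc₀ hδπ₀ hC hle⟩
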